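/- Let $(M,g,J,\omega)$ be a Kähler manifold of real dimension $2m$ with Levi-Civita connection $\nabla$ and Kähler form $\omega=g(J\cdot,\cdot)$. Let $\psi$ be a Hamiltonian $2$-form, i.e. a real $2$-form of type $(1,1)$ such that, for a smooth real function $\sigma$, $$\nabla_X\psi=\tfrac12\bigl(d\sigma\wedge J X^*-J d\sigma\wedge X^*\bigr)\qquad\text{for all vector fields }X ,$$ where $X^*=g(X,\cdot)$, $J\alpha=-\alpha\circ J$ on $1$-forms and $\alpha\wedge\beta=\alpha\otimes\beta-\beta\otimes\alpha$. (This forces $\sigma$ to be, up to a locally constant function, the trace $\mathrm{tr}_\omega\psi$.) Suppose that $\psi$ is non-degenerate with distinct eigenvalues, i.e. at every point the endomorphism $A$ of $TM$ with $\psi(v,w)=g(v,Aw)$ has $2m$ distinct complex eigenvalues. Then the eigenvalues of $A$ are $\pm i a_1,\dots,\pm i a_m$ for smooth real functions $0<a_1<\dots<a_m$ on $M$. For each of the $2^m$ choices of one eigenvalue out of each pair $\pm i a_\mu$, let $D\subset T_{\mathbb C}M$ be spanned by the corresponding eigenvectors. Each $D$ is a smooth distribution of rank $m$, is maximal isotropic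 for $g$ (extended complex-bilinearly), and is integrable, $[D,D]\subset D$. The $2^m$ distributions are pairwise distinct at every point, and they define $2^m$ complex structures $J_D$ (integrable almost complex structures, with vanishing Nijenhuis tensor), with respect to which $g$ is Hermitian, $D$ being the bundle $T^{1,0}$ of $J_D$; the $J_D$ are pairwise distinct at every point. Moreover $\varphi=\psi-\tfrac12\sigma\omega$ is a conformal Killing–Yano tensor, i.e. with $n=2m$ there are a $3$-form $\tau$ and a $1$-form $K$ such that $\nabla_X\varphi=\tfrac13 X\lrcorner\tau+\tfrac1{n-1}X^*\wedge K$ for all $X$. Every eigenvector of $\psi$ is an eigenvector of $\varphi$, so that the distributions $D$ are also spanned by eigenvectors of $\varphi$; and if $m\ge2$, then $\varphi$ is closed if and only if it is parallel. -/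

import Mathlib

open Bundle VectorField Module
open scoped Manifold ContDiff Bundle TensorProduct

noncomputable section

namespace HamiltonianForms

variable {E : Type*} [NormedAddCommGroup E] [NormedSpace ℝ E]
  {M : Type*} [TopologicalSpace M] [ChartedSpace E M]

/-! ### Real tensor fields -/

variable (E M) in
/-- Real vector fields on `M` (no regularity). -/
abbrev VField : Type _ := Π x : M, TangentSpace 𝓘(ℝ, E) x

variable (E M) in
/-- Fields of endomorphisms of the tangent spaces (no regularity). -/
abbrev EndField : Type _ :=
  Π x : M, TangentSpace 𝓘(ℝ, E) x →L[ℝ] TangentSpace 𝓘(ℝ, E) x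

variable (E M) in
/-- Fields of bilinear forms on the tangent spaces (no regularity). -/
abbrev BilinField : Type _ :=
  Π x : M, TangentSpace 𝓘(ℝ, E) x →L[ℝ] TangentSpace 𝓘(ℝ, E) x →L[ℝ] ℝ

/-- The vector field `J X`. -/
def EndField.app (J : EndField E M) (X : VField E M) : VField E M := fun x => J x (X x)

/-- A field of endomorphisms is a smooth section of `End(TM)`. -/
def IsSmoothEnd [IsManifold 𝓘(ℝ, E) ∞ M] (J : EndField E M) : Prop :=
  ContMDiff 𝓘(ℝ, E) (𝓘(ℝ, E).prod 𝓘(ℝ, E →L[ℝ] E)) ∞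
    (fun x => TotalSpace.mk' (E →L[ℝ] E)
      (E := fun x : M => TangentSpace 𝓘(ℝ, E) x →L[ℝ] TangentSpace 𝓘(ℝ, E) x) x (J x))

/-- A smooth differential `2`-form. -/
structure IsTwoForm [IsManifold 𝓘(ℝ, E) ∞ M] (β : BilinField E M) : Prop where
  smooth : ContMDiff 𝓘(ℝ, E) (𝓘(ℝ, E).prod 𝓘(ℝ, E →L[ℝ] E →L[ℝ] ℝ)) ∞
    (fun x => TotalSpace.mk' (E →L[ℝ] E →L[ℝ] ℝ)
      (E := fun x : M => TangentSpace 𝓘(ℝ, E) x →L[ℝ] TangentSpace 𝓘(ℝ, E) x →L[ℝ] ℝ) x (β x))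
  alt : ∀ x v, β x v v = 0

/-- The exterior derivative of a `2`-form evaluated on vector fields:
`dβ(X,Y,Z) = X β(Y,Z) - Y β(X,Z) + Z β(X,Y) - β([X,Y],Z) + β([X,Z],Y) - β([Y,Z],X)`. -/
def extDeriv₂ (β : BilinField E M) (X Y Z : VField E M) (x : M) : ℝ :=
  mvfderiv 𝓘(ℝ, E) (fun y => β y (Y y) (Z y)) x (X x)
    - mvfderiv 𝓘(ℝ, E) (fun y => β y (X y) (Z y)) x (Y x)
    + mvfderiv 𝓘(ℝ, E) (fun y => β y (X y) (Y y)) x (Z x)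
    - β x (mlieBracket 𝓘(ℝ, E) X Y x) (Z x)
    + β x (mlieBracket 𝓘(ℝ, E) X Z x) (Y x)
    - β x (mlieBracket 𝓘(ℝ, E) Y Z x) (X x)

/-- A `2`-form is closed. -/
def IsClosedForm [IsManifold 𝓘(ℝ, E) ∞ M] (β : BilinField E M) : Prop :=
  ∀ (x : M) (X Y Z : VField E M), MDiffAt (T% X) x → MDiffAt (T% Y) x → MDiffAt (T% Z) x →
    extDeriv₂ β X Y Z x = 0

/-- The covariant derivative of a bilinear form evaluated on vector fields:
`(∇_v β)(Y,Z) = v (β(Y,Z)) - β(∇_v Y, Z) - β(Y, ∇_v Z)` for a tangent vector `v` at `x`. -/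
def covDeriv₂ [IsManifold 𝓘(ℝ, E) ∞ M]
    (cov : CovariantDerivative 𝓘(ℝ, E) E (fun x : M => TangentSpace 𝓘(ℝ, E) x))
    (β : BilinField E M) (x : M) (v : TangentSpace 𝓘(ℝ, E) x) (Y Z : VField E M) : ℝ :=
  mvfderiv 𝓘(ℝ, E) (fun y => β y (Y y) (Z y)) x v
    - β x (cov Y x v) (Z x) - β x (Y x) (cov Z x v)

/-- A bilinear form is parallel. -/
def IsParallelForm [IsManifold 𝓘(ℝ, E) ∞ M]
    (cov : CovariantDerivative 𝓘(ℝ, E) E (fun x : M => TangentSpace 𝓘(ℝ, E) x))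
    (β : BilinField E M) : Prop :=
  ∀ (x : M) (v : TangentSpace 𝓘(ℝ, E) x) (Y Z : VField E M),
    MDiffAt (T% Y) x → MDiffAt (T% Z) x → covDeriv₂ cov β x v Y Z = 0

/-! ### Complex structures -/

/-- A complex structure, as an integrable almost complex structure: a smooth `J` with `J² = -1`
and vanishing Nijenhuis tensor `[JX,JY] - J[JX,Y] - J[X,JY] - [X,Y]`. -/
structure IsComplexStructure [IsManifold 𝓘(ℝ, E) ∞ M] (J : EndField E M) : Prop where
  smooth : IsSmoothEnd J
  sq : ∀ x v, J x (J x v) = -v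
  integrable : ∀ (x : M) (X Y : VField E M), MDiffAt (T% X) x → MDiffAt (T% Y) x →
    mlieBracket 𝓘(ℝ, E) (J.app X) (J.app Y) x
      - J x (mlieBracket 𝓘(ℝ, E) (J.app X) Y x)
      - J x (mlieBracket 𝓘(ℝ, E) X (J.app Y) x)
      - mlieBracket 𝓘(ℝ, E) X Y x = 0

/-! ### Complex vector fields and complex distributions -/

variable (E M) in
/-- A complex distribution: a complex subspace of each complexified tangent space. -/
abbrev CDistribution : Type _ :=
  Π x : M, Submodule ℂ (ℂ ⊗[ℝ] TangentSpace 𝓘(ℝ, E) x)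

/-- The complex tangent vector `v + i w`. -/
def cvec {x : M} (v w : TangentSpace 𝓘(ℝ, E) x) : ℂ ⊗[ℝ] TangentSpace 𝓘(ℝ, E) x :=
  (1 : ℂ) ⊗ₜ[ℝ] v + Complex.I ⊗ₜ[ℝ] w

/-- The complex-linear extension of an endomorphism of a tangent space. -/
def cEnd {x : M} (A : TangentSpace 𝓘(ℝ, E) x →L[ℝ] TangentSpace 𝓘(ℝ, E) x) :
    Module.End ℂ (ℂ ⊗[ℝ] TangentSpace 𝓘(ℝ, E) x) :=
  (A : TangentSpace 𝓘(ℝ, E) x →ₗ[ℝ] TangentSpace 𝓘(ℝ, E) x).baseChange ℂ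

/-- `D` is a smooth complex vector subbundle of rank `r` of the complexified tangent bundle: near
each point it is spanned by `r` smooth complex vector fields `X j + i Y j` that are pointwise
linearly independent over `ℂ`. -/
def IsSmoothOfRank [IsManifold 𝓘(ℝ, E) ∞ M] (D : CDistribution E M) (r : ℕ) : Prop :=
  ∀ x₀ : M, ∃ U : Set M, IsOpen U ∧ x₀ ∈ U ∧ ∃ X Y : Fin r → VField E M,
    (∀ j, CMDiff[U] ∞ (T% (X j)) ∧ CMDiff[U] ∞ (T% (Y j))) ∧
    ∀ x ∈ U, LinearIndependent ℂ (fun j => cvec (X j x) (Y j x)) ∧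
      Submodule.span ℂ (Set.range fun j => cvec (X j x) (Y j x)) = D x

/-- Frobenius integrability `[D, D] ⊆ D`: the bracket
`[X + iY, X' + iY'] = ([X,X'] - [Y,Y']) + i ([X,Y'] + [Y,X'])` of any two smooth local sections of
`D`, on any open set, is a section of `D`. -/
def IsInvolutive [IsManifold 𝓘(ℝ, E) ∞ M] (D : CDistribution E M) : Prop :=
  ∀ (U : Set M), IsOpen U → ∀ X Y X' Y' : VField E M,
    CMDiff[U] ∞ (T% X) → CMDiff[U] ∞ (T% Y) → CMDiff[U] ∞ (T% X') → CMDiff[U] ∞ (T% Y') →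
    (∀ x ∈ U, cvec (X x) (Y x) ∈ D x) → (∀ x ∈ U, cvec (X' x) (Y' x) ∈ D x) →
    ∀ x ∈ U,
      cvec (mlieBracket 𝓘(ℝ, E) X X' x - mlieBracket 𝓘(ℝ, E) Y Y' x)
        (mlieBracket 𝓘(ℝ, E) X Y' x + mlieBracket 𝓘(ℝ, E) Y X' x) ∈ D x

/-! ### Riemannian notions -/

section Riemannian

variable [FiniteDimensional ℝ E] [IsManifold 𝓘(ℝ, E) ∞ M]
  [RiemannianBundle (fun x : M => TangentSpace 𝓘(ℝ, E) x)]

instance (x : M) : FiniteDimensional ℝ (TangentSpace 𝓘(ℝ, E) x) :=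
  inferInstanceAs (FiniteDimensional ℝ E)

/-- The endomorphism `A` obtained from a bilinear form `β` by raising an index with the metric:
`g(v, A w) = β(v, w)`. -/
def sharp (β : BilinField E M) : EndField E M := fun x =>
  InnerProductSpace.continuousLinearMapOfBilin (𝕜 := ℝ) (β x).flip

lemma inner_sharp (β : BilinField E M) (x : M) (v w : TangentSpace 𝓘(ℝ, E) x) :
    inner ℝ v (sharp β x w) = β x v w := by
  rw [real_inner_comm]
  exact InnerProductSpace.continuousLinearMapOfBilin_apply _ w v

/-- The metric vanishes on `D`, where the metric is extended complex-bilinearly. -/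
def IsIsotropic (D : CDistribution E M) : Prop :=
  ∀ x, ∀ v ∈ D x, ∀ w ∈ D x,
    LinearMap.BilinForm.baseChange ℂ (innerₗ (TangentSpace 𝓘(ℝ, E) x)) v w = 0

/-- `J` is orthogonal for the metric. -/
def IsOrthogonalEnd (J : EndField E M) : Prop :=
  ∀ x (v w : TangentSpace 𝓘(ℝ, E) x), inner ℝ (J x v) (J x w) = (inner ℝ v w : ℝ)

/-- The form `ω(v, w) = g(J v, w)`. -/
def fundForm (J : EndField E M) : BilinField E M := fun x =>
  ContinuousLinearMap.comp (innerSL ℝ) (J x)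

lemma fundForm_apply (J : EndField E M) (x : M) (v w : TangentSpace 𝓘(ℝ, E) x) :
    fundForm J x v w = inner ℝ (J x v) w := rfl

/-- `(g, J)` is a Kähler structure: `J` is a complex structure, `g` is Hermitian, and the
Kähler form `ω = g(J·,·)` is closed. -/
structure IsKaehler (J : EndField E M) : Prop where
  complex : IsComplexStructure J
  hermitian : IsOrthogonalEnd J
  closed : IsClosedForm (fundForm J)

/-- `cov` is the Levi-Civita connection: it is compatible with the metric and torsion-free. -/
structure IsLeviCivita
    (cov : CovariantDerivative 𝓘(ℝ, E) E (fun x : M => TangentSpace 𝓘(ℝ, E) x)) : Prop where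
  metric : ∀ (x : M) (v : TangentSpace 𝓘(ℝ, E) x) (Y Z : VField E M),
    MDiffAt (T% Y) x → MDiffAt (T% Z) x →
    mvfderiv 𝓘(ℝ, E) (fun y => (inner ℝ (Y y) (Z y) : ℝ)) x v =
      inner ℝ (cov Y x v) (Z x) + inner ℝ (Y x) (cov Z x v)
  torsion : cov.torsion = 0

/-- `ψ` is a Hamiltonian `2`-form with associated smooth function `σ`: `ψ` is a `2`-form of type
`(1,1)`, and `∇_v ψ = ½ (dσ ∧ J v* - J dσ ∧ v*)` for all tangent vectors `v`. Here
`J α = - α ∘ J` on `1`-forms, so that `J v* = (J v)*`, and `α ∧ β = α ⊗ β - β ⊗ α`. -/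
structure IsHamiltonian
    (cov : CovariantDerivative 𝓘(ℝ, E) E (fun x : M => TangentSpace 𝓘(ℝ, E) x))
    (J : EndField E M) (ψ : BilinField E M) (σ : M → ℝ) : Prop where
  form : IsTwoForm ψ
  oneOne : ∀ x v w, ψ x (J x v) (J x w) = ψ x v w
  smooth : ContMDiff 𝓘(ℝ, E) 𝓘(ℝ, ℝ) ∞ σ
  eqn : ∀ (x : M) (v : TangentSpace 𝓘(ℝ, E) x) (Y Z : VField E M),
    MDiffAt (T% Y) x → MDiffAt (T% Z) x →
    covDeriv₂ cov ψ x v Y Z =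
      1 / 2 * (
        (mvfderiv 𝓘(ℝ, E) σ x (Y x) * inner ℝ (J x v) (Z x)
          - mvfderiv 𝓘(ℝ, E) σ x (Z x) * inner ℝ (J x v) (Y x))
        - ((-mvfderiv 𝓘(ℝ, E) σ x (J x (Y x))) * inner ℝ v (Z x)
          - (-mvfderiv 𝓘(ℝ, E) σ x (J x (Z x))) * inner ℝ v (Y x)))

/-- Non-degeneracy of a bilinear form, at every point. -/
def IsNondegenerate (β : BilinField E M) : Prop :=
  ∀ x v, (∀ w, β x v w = 0) → v = 0

/-- At every point the endomorphism obtained by raising an index has as many distinct complex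
eigenvalues as the dimension of `M`. -/
def HasDistinctEigenvalues (β : BilinField E M) : Prop :=
  ∀ x, {z : ℂ | (cEnd (sharp β x)).HasEigenvalue z}.ncard = finrank ℝ E

/-- `φ` is a conformal Killing `2`-form (conformal Killing-Yano tensor) on a manifold of
dimension `n`: a `2`-form with `∇_v φ = ⅓ v ⌟ τ + 1/(n-1) v* ∧ K` for a `3`-form `τ` and a
`1`-form `K`. -/
def IsConformalKilling
    (cov : CovariantDerivative 𝓘(ℝ, E) E (fun x : M => TangentSpace 𝓘(ℝ, E) x))
    (φ : BilinField E M) : Prop :=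
  IsTwoForm φ ∧
  ∃ (τ : Π x : M, (TangentSpace 𝓘(ℝ, E) x) [⋀^Fin 3]→ₗ[ℝ] ℝ)
    (K : Π x : M, TangentSpace 𝓘(ℝ, E) x →L[ℝ] ℝ),
    ∀ (x : M) (v : TangentSpace 𝓘(ℝ, E) x) (Y Z : VField E M),
      MDiffAt (T% Y) x → MDiffAt (T% Z) x →
      covDeriv₂ cov φ x v Y Z =
        1 / 3 * τ x ![v, Y x, Z x]
          + 1 / ((finrank ℝ E : ℝ) - 1) * (inner ℝ v (Y x) * K x (Z x) - inner ℝ v (Z x) * K x (Y x))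

/-- The form `ψ - ½ σ ω`. -/
def shiftedForm (J : EndField E M) (ψ : BilinField E M) (σ : M → ℝ) : BilinField E M :=
  fun x => ψ x - (σ x / 2) • fundForm J x

/-- The distribution spanned, at each point, by one eigenvector from each pair of eigenvalues
`± i a μ` of the endomorphism of `β`; the sign in the `μ`-th pair is chosen by `s μ`. -/
def eigenDistribution {m : ℕ} (β : BilinField E M) (a : Fin m → M → ℝ) (s : Fin m → Bool) :
    CDistribution E M := fun x =>
  ⨆ μ : Fin m, Module.End.eigenspace (cEnd (sharp β x))
    (if s μ then (a μ x : ℂ) * Complex.I else -((a μ x : ℂ) * Complex.I))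

/-- The bundle `T^{1,0}` of `J`: the `i`-eigenspaces in the complexified tangent spaces. -/
def holTangent (J : EndField E M) : CDistribution E M := fun x =>
  Module.End.eigenspace (cEnd (J x)) Complex.I

end Riemannian

end HamiltonianForms

end

/-!
The endomorphism `A` of `ψ` is skew and nondegenerate with simple spectrum, so its eigenvalues are
`± i a μ`, and the `a μ` are simple roots of the real polynomial `τ ↦ det (i τ - A)`, hence smooth
by the implicit function theorem. A choice of signs corresponds to the structure `S = q(A)`, where
the real polynomial `q` takes the values `± i` at the eigenvalues.

The Hamiltonian equation makes the Nijenhuis-type expression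
`(∇_{Sv} A) S - S (∇_{Sv} A) - S (∇_v A) S - ∇_v A` vanish for every orthogonal `S` with `S² = -1`
that commutes with `J`. Together with the derivative of `A S = S A` this makes
`∇_{Sv} S - S (∇_v S)` commute with `A`, hence with `S = q(A)`. It anticommutes with `S` because
`S² = -1`, so it is zero, which is the integrability of `S`.

As `ω` is parallel, `∇φ` is explicit in `dσ`; the exterior derivative of `φ` is a multiple of
`dσ ∧ ω`, which in dimension greater than two vanishes only if `dσ` does.
-/

namespace HamiltonianForms

/-! ### Complexified real vector spaces -/

section Complexification

variable {V : Type*} [AddCommGroup V] [Module ℝ V]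

lemma tmul_eq_one_tmul_add_I_tmul (c : ℂ) (v : V) :
    c ⊗ₜ[ℝ] v = (1 : ℂ) ⊗ₜ[ℝ] (c.re • v) + Complex.I ⊗ₜ[ℝ] (c.im • v) := by
  rw [← TensorProduct.smul_tmul, ← TensorProduct.smul_tmul, ← TensorProduct.add_tmul]
  congr 1
  apply Complex.ext <;> simp

lemma exists_eq_one_tmul_add_I_tmul (z : ℂ ⊗[ℝ] V) :
    ∃ u w : V, z = (1 : ℂ) ⊗ₜ[ℝ] u + Complex.I ⊗ₜ[ℝ] w := by
  induction z using TensorProduct.induction_on with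
  | zero => exact ⟨0, 0, by simp⟩
  | tmul c v => exact ⟨_, _, tmul_eq_one_tmul_add_I_tmul c v⟩
  | add x y hx hy =>
    obtain ⟨u, w, rfl⟩ := hx
    obtain ⟨u', w', rfl⟩ := hy
    exact ⟨u + u', w + w', by simp only [TensorProduct.tmul_add]; abel⟩

lemma one_tmul_add_I_tmul_eq_zero_iff {u w : V} :
    (1 : ℂ) ⊗ₜ[ℝ] u + Complex.I ⊗ₜ[ℝ] w = 0 ↔ u = 0 ∧ w = 0 := by
  refine ⟨fun h => ?_, by rintro ⟨rfl, rfl⟩; simp⟩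
  have hcoord i := DFunLike.congr_fun
    (congrArg (TensorProduct.equivFinsuppOfBasisLeft (N := V) Complex.basisOneI) h) i
  exact ⟨by simpa using hcoord 0, by simpa using hcoord 1⟩

lemma one_tmul_add_I_tmul_inj {u w u' w' : V} :
    (1 : ℂ) ⊗ₜ[ℝ] u + Complex.I ⊗ₜ[ℝ] w = (1 : ℂ) ⊗ₜ[ℝ] u' + Complex.I ⊗ₜ[ℝ] w' ↔
      u = u' ∧ w = w' := by
  rw [← sub_eq_zero, ← sub_eq_zero (a := u), ← sub_eq_zero (a := w),
    ← one_tmul_add_I_tmul_eq_zero_iff, TensorProduct.tmul_sub, TensorProduct.tmul_sub,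
    add_sub_add_comm]

lemma smul_one_tmul_add_I_tmul (c : ℂ) (u w : V) :
    c • ((1 : ℂ) ⊗ₜ[ℝ] u + Complex.I ⊗ₜ[ℝ] w) =
      (1 : ℂ) ⊗ₜ[ℝ] (c.re • u - c.im • w) + Complex.I ⊗ₜ[ℝ] (c.re • w + c.im • u) := by
  rw [smul_add, TensorProduct.smul_tmul', TensorProduct.smul_tmul',
    tmul_eq_one_tmul_add_I_tmul (c • 1), tmul_eq_one_tmul_add_I_tmul (c • Complex.I),
    add_add_add_comm, ← TensorProduct.tmul_add, ← TensorProduct.tmul_add]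
  simp [sub_eq_add_neg, add_comm]

lemma baseChange_apply_eq_smul_iff (A : End ℝ V) (c : ℂ) (u w : V) :
    A.baseChange ℂ ((1 : ℂ) ⊗ₜ[ℝ] u + Complex.I ⊗ₜ[ℝ] w) =
        c • ((1 : ℂ) ⊗ₜ[ℝ] u + Complex.I ⊗ₜ[ℝ] w) ↔
      A u = c.re • u - c.im • w ∧ A w = c.re • w + c.im • u := by
  rw [smul_one_tmul_add_I_tmul, map_add, LinearMap.baseChange_tmul, LinearMap.baseChange_tmul,
    one_tmul_add_I_tmul_inj]

lemma hasEigenvalue_baseChange_iff (A : End ℝ V) (c : ℂ) :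
    End.HasEigenvalue (A.baseChange ℂ) c ↔
      ∃ u w : V, ¬ (u = 0 ∧ w = 0) ∧ A u = c.re • u - c.im • w ∧ A w = c.re • w + c.im • u := by
  simp only [← baseChange_apply_eq_smul_iff, ← one_tmul_add_I_tmul_eq_zero_iff]
  constructor
  · intro h
    obtain ⟨z, hz⟩ := h.exists_hasEigenvector
    obtain ⟨u, w, rfl⟩ := exists_eq_one_tmul_add_I_tmul z
    exact ⟨u, w, hz.2, hz.apply_eq_smul⟩
  · rintro ⟨u, w, hne, h⟩
    exact End.hasEigenvalue_of_hasEigenvector ⟨End.mem_eigenspace_iff.2 h, hne⟩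

lemma hasEigenvalue_baseChange_conj {A : End ℝ V} {c : ℂ}
    (h : End.HasEigenvalue (A.baseChange ℂ) c) :
    End.HasEigenvalue (A.baseChange ℂ) (star c) := by
  rw [hasEigenvalue_baseChange_iff] at h ⊢
  obtain ⟨u, w, hne, hu, hw⟩ := h
  exact ⟨u, -w, by simpa using hne, by simp [hu], by simp [hw]; abel⟩

lemma ne_zero_of_hasEigenvalue_baseChange {A : End ℝ V} (hA : ∀ v, A v = 0 → v = 0) {c : ℂ}
    (h : End.HasEigenvalue (A.baseChange ℂ) c) : c ≠ 0 := by
  rintro rfl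
  obtain ⟨u, w, hne, hu, hw⟩ := (hasEigenvalue_baseChange_iff A 0).1 h
  exact hne ⟨hA u (by simpa using hu), hA w (by simpa using hw)⟩

lemma baseChange_aeval (A : End ℝ V) (q : Polynomial ℝ) :
    (Polynomial.aeval A q : End ℝ V).baseChange ℂ =
      Polynomial.aeval (A.baseChange ℂ : End ℂ (ℂ ⊗[ℝ] V)) (q.map (algebraMap ℝ ℂ)) := by
  rw [Polynomial.aeval_map_algebraMap]
  exact (Polynomial.aeval_algHom_apply (End.baseChangeHom ℝ ℂ V) A q).symm

lemma baseChange_aeval_apply_of_mem_eigenspace {A : End ℝ V} {c : ℂ} {z : ℂ ⊗[ℝ] V}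
    (h : z ∈ End.eigenspace (A.baseChange ℂ) c) (q : Polynomial ℝ) :
    (Polynomial.aeval A q : End ℝ V).baseChange ℂ z = Polynomial.aeval c q • z := by
  rcases eq_or_ne z 0 with rfl | hz
  · simp
  rw [baseChange_aeval, End.aeval_apply_of_hasEigenvector ⟨h, hz⟩, Polynomial.eval_map_algebraMap]

end Complexification

/-! ### Endomorphisms diagonal in a basis -/

section Diagonal

variable {K V ι : Type*} [Field K] [AddCommGroup V] [Module K V] {f : End K V} {b : Basis ι K V}
  {c : ι → K}

lemma repr_apply_of_diagonal (hb : ∀ i, f (b i) = c i • b i) (v : V) (i : ι) :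
    b.repr (f v) i = c i * b.repr v i := by
  classical
  have hcoord : b.coord i ∘ₗ f = c i • b.coord i := by
    refine b.ext fun j => ?_
    rcases eq_or_ne j i with rfl | hji <;> simp [*]
  exact LinearMap.congr_fun hcoord v

lemma eigenspace_eq_span_of_diagonal (hb : ∀ i, f (b i) = c i • b i) (μ : K) :
    End.eigenspace f μ = Submodule.span K (b '' {i | c i = μ}) := by
  ext v
  rw [End.mem_eigenspace_iff, b.ext_elem_iff, b.mem_span_image]
  simp only [repr_apply_of_diagonal hb, map_smul, Finsupp.smul_apply, smul_eq_mul,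
    mul_eq_mul_right_iff, Set.subset_def, Finset.mem_coe, Finsupp.mem_support_iff,
    Set.mem_ofPred_eq, or_iff_not_imp_right]

lemma hasEigenvalue_iff_of_diagonal (hb : ∀ i, f (b i) = c i • b i) (μ : K) :
    End.HasEigenvalue f μ ↔ ∃ i, c i = μ := by
  rw [End.hasEigenvalue_iff, eigenspace_eq_span_of_diagonal hb, Ne, Submodule.span_eq_bot]
  simp [b.ne_zero]

lemma charpoly_eq_prod_of_diagonal [Fintype ι] [FiniteDimensional K V]
    (hb : ∀ i, f (b i) = c i • b i) :
    f.charpoly = ∏ i, (Polynomial.X - Polynomial.C (c i)) := by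
  classical
  have hdiag : LinearMap.toMatrix b b f = Matrix.diagonal c := by
    ext i j
    rcases eq_or_ne i j with rfl | hij <;> simp [LinearMap.toMatrix_apply, *]
  rw [← LinearMap.charpoly_toMatrix f b, hdiag, Matrix.charpoly_diagonal]

end Diagonal

/-! ### Spectra on the imaginary axis -/

section ImaginaryAxis

open Complex (I)

/-- The imaginary number `± i t`, the sign being `+` for `true`. -/
noncomputable def signedImag (t : ℝ) (s : Bool) : ℂ :=
  if s then (t : ℂ) * I else -((t : ℂ) * I)

lemma signedImag_eq (t : ℝ) (s : Bool) :
    signedImag t s = ((if s then t else -t : ℝ) : ℂ) * I := by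
  cases s <;> simp [signedImag]

lemma signedImag_sq (t : ℝ) (s : Bool) : signedImag t s ^ 2 = ((-t ^ 2 : ℝ) : ℂ) := by
  rw [signedImag_eq, mul_pow, Complex.I_sq]
  cases s <;> simp

lemma neg_signedImag (t : ℝ) (s : Bool) : -signedImag t s = signedImag t (!s) := by
  cases s <;> simp [signedImag]

lemma injOn_signedImag :
    Set.InjOn (fun k : ℝ × Bool => signedImag k.1 k.2) (Set.Ioi 0 ×ˢ Set.univ) := by
  rintro ⟨t, s⟩ ⟨ht, -⟩ ⟨t', s'⟩ ⟨ht', -⟩ h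
  have h : (if s then t else -t) = if s' then t' else -t' := by
    simpa [signedImag_eq, Complex.ofReal_inj] using h
  simp only [Set.mem_Ioi] at ht ht'
  cases s <;> cases s' <;> simp at h ⊢ <;> linarith

lemma exists_signedImag_eq {z : ℂ} (hre : z.re = 0) (hz : z ≠ 0) :
    ∃ t s, 0 < t ∧ signedImag t s = z := by
  have him : z.im ≠ 0 := fun h => hz (Complex.ext hre h)
  rcases him.lt_or_gt with h | h
  · exact ⟨-z.im, false, neg_pos.2 h, by apply Complex.ext <;> simp [signedImag, hre]⟩
  · exact ⟨z.im, true, h, by apply Complex.ext <;> simp [signedImag, hre]⟩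

lemma exists_strictMono_signedImag {m : ℕ} {L : Set ℂ} (hfin : L.Finite) (hcard : L.ncard = 2 * m)
    (hre : ∀ z ∈ L, z.re = 0) (hzero : (0 : ℂ) ∉ L) (hneg : ∀ z ∈ L, -z ∈ L) :
    ∃ a : Fin m → ℝ, (∀ μ, 0 < a μ) ∧ StrictMono a ∧
      ∀ μ s, signedImag (a μ) s ∈ L := by
  set S : Set ℝ := {t | 0 < t ∧ signedImag t true ∈ L}
  have hS : ∀ t ∈ S, ∀ s, signedImag t s ∈ L := by
    rintro t ⟨-, ht⟩ (_ | _)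
    · simpa [neg_signedImag] using hneg _ ht
    · exact ht
  have hL : L = (fun k : ℝ × Bool => signedImag k.1 k.2) '' (S ×ˢ Set.univ) := by
    ext z
    constructor
    · intro hz
      obtain ⟨t, s, ht, rfl⟩ := exists_signedImag_eq (hre z hz) fun h => hzero (h ▸ hz)
      refine ⟨(t, s), ⟨⟨ht, ?_⟩, Set.mem_univ s⟩, rfl⟩
      cases s
      · simpa [neg_signedImag] using hneg _ hz
      · exact hz
    · rintro ⟨⟨t, s⟩, ⟨ht, -⟩, rfl⟩
      exact hS t ht s
  have hinj := injOn_signedImag.mono (Set.prod_mono (s₁ := S) (fun t ht => ht.1) subset_rfl)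
  have hSfin : S.Finite := by
    rw [hL, Set.finite_image_iff hinj] at hfin
    simpa [Set.fst_image_prod, Set.univ_nonempty] using hfin.image Prod.fst
  have hScard : hSfin.toFinset.card = m := by
    rw [hL, hinj.ncard_image, Set.ncard_prod, Set.ncard_univ, Nat.card_eq_two_iff.2
      ⟨true, false, by simp, by ext (_ | _) <;> simp⟩, mul_comm] at hcard
    rw [← Set.ncard_eq_toFinset_card S hSfin]
    omega
  have hmem μ : hSfin.toFinset.orderEmbOfFin hScard μ ∈ S :=
    hSfin.mem_toFinset.1 (Finset.orderEmbOfFin_mem _ _ μ)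
  exact ⟨hSfin.toFinset.orderEmbOfFin hScard, fun μ => (hmem μ).1, OrderEmbedding.strictMono _,
    fun μ => hS _ (hmem μ)⟩

end ImaginaryAxis

section Skew

variable {V : Type*} [NormedAddCommGroup V] [InnerProductSpace ℝ V] {A : End ℝ V}

lemma re_eq_zero_of_hasEigenvalue_baseChange
    (hskew : ∀ v w, inner ℝ (A v) w = -(inner ℝ v (A w) : ℝ)) {c : ℂ}
    (h : End.HasEigenvalue (A.baseChange ℂ) c) : c.re = 0 := by
  obtain ⟨u, w, hne, hu, hw⟩ := (hasEigenvalue_baseChange_iff A c).1 h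
  have hself v : (inner ℝ (A v) v : ℝ) = 0 := by
    linarith [hskew v v, real_inner_comm (A v) v]
  have hsum : c.re * (‖u‖ ^ 2 + ‖w‖ ^ 2) = 0 := by
    have hAu := hself u
    have hAw := hself w
    rw [hu, inner_sub_left, real_inner_smul_left, real_inner_smul_left,
      real_inner_self_eq_norm_sq] at hAu
    rw [hw, inner_add_left, real_inner_smul_left, real_inner_smul_left,
      real_inner_self_eq_norm_sq, real_inner_comm] at hAw
    linarith
  refine (mul_eq_zero.1 hsum).resolve_right fun hnorm => hne ?_
  constructor <;> rw [← norm_eq_zero, ← sq_eq_zero_iff] <;> nlinarith [sq_nonneg ‖u‖, sq_nonneg ‖w‖]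

lemma exists_strictMono_hasEigenvalue_signedImag [FiniteDimensional ℝ V] {m : ℕ}
    (hskew : ∀ v w, inner ℝ (A v) w = -(inner ℝ v (A w) : ℝ)) (hA : ∀ v, A v = 0 → v = 0)
    (hcard : {z : ℂ | End.HasEigenvalue (A.baseChange ℂ) z}.ncard = 2 * m) :
    ∃ a : Fin m → ℝ, (∀ μ, 0 < a μ) ∧ StrictMono a ∧
      ∀ μ s, End.HasEigenvalue (A.baseChange ℂ) (signedImag (a μ) s) := by
  refine exists_strictMono_signedImag (End.finite_hasEigenvalue _) hcard
    (fun z hz => re_eq_zero_of_hasEigenvalue_baseChange hskew hz)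
    (fun h => ne_zero_of_hasEigenvalue_baseChange hA h rfl) fun z hz => ?_
  have hconj : star z = -z :=
    Complex.ext (by simp [re_eq_zero_of_hasEigenvalue_baseChange hskew hz]) (by simp)
  exact hconj ▸ hasEigenvalue_baseChange_conj hz

end Skew

/-! ### Sign polynomials -/

section Polynomials

open Polynomial

variable {ι : Type*} [Fintype ι] [DecidableEq ι]

/-- The real polynomial with value `1` at `± i a μ` and `0` at `± i a ν` for `ν ≠ μ`, used to
project onto pairs of conjugate eigenspaces. -/
noncomputable def pairProjection (a : ι → ℝ) (μ : ι) : ℝ[X] :=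
  (Lagrange.basis Finset.univ (fun ν => -a ν ^ 2) μ).comp (X ^ 2)

/-- The real polynomial with value `i` at the points `± i a μ` selected by `s`, and `-i` at their
conjugates. Its value at a skew endomorphism is the almost complex structure attached to `s`. -/
noncomputable def signPolynomial (a : ι → ℝ) (s : ι → Bool) : ℝ[X] :=
  ∑ μ, C (if s μ then (a μ)⁻¹ else -(a μ)⁻¹) * (X * pairProjection a μ)

variable {a : ι → ℝ}

lemma aeval_signedImag_pairProjection (ha : ∀ μ, 0 < a μ) (hinj : Function.Injective a) (μ κ : ι)
    (t : Bool) : aeval (signedImag (a κ) t) (pairProjection a μ) = if μ = κ then 1 else 0 := by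
  have hsq : Set.InjOn (fun ν => -a ν ^ 2) (Finset.univ : Finset ι) := fun μ _ ν _ h =>
    hinj ((pow_left_inj₀ (ha μ).le (ha ν).le two_ne_zero).1 (neg_inj.1 h))
  rw [pairProjection, aeval_comp, map_pow, aeval_X, signedImag_sq, ← Complex.coe_algebraMap,
    aeval_algebraMap_apply_eq_algebraMap_eval]
  split_ifs with h
  · rw [← h, Lagrange.eval_basis_self hsq (Finset.mem_univ μ), map_one]
  · rw [Lagrange.eval_basis_of_ne (v := fun ν => -a ν ^ 2) h (Finset.mem_univ κ), map_zero]

lemma aeval_signedImag_signPolynomial (ha : ∀ μ, 0 < a μ) (hinj : Function.Injective a)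
    (s : ι → Bool) (κ : ι) (t : Bool) :
    aeval (signedImag (a κ) t) (signPolynomial a s) =
      if s κ = t then Complex.I else -Complex.I := by
  have hκ : ((a κ : ℝ) : ℂ) ≠ 0 := by exact_mod_cast (ha κ).ne'
  simp only [signPolynomial, map_sum, map_mul, aeval_X, aeval_C,
    aeval_signedImag_pairProjection ha hinj, mul_ite, mul_one, mul_zero, Finset.sum_ite_eq',
    Finset.mem_univ, if_true]
  cases s κ <;> cases t <;> simp [signedImag, hκ]

lemma commute_aeval {R B : Type*} [CommSemiring R] [Semiring B] [Algebra R B] {x y : B}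
    (h : Commute x y) (q : R[X]) : Commute x (aeval y q) := by
  induction q using Polynomial.induction_on' with
  | add p q hp hq => simpa only [map_add] using hp.add_right hq
  | monomial n c =>
    rw [aeval_monomial]
    exact Commute.mul_right (Algebra.commutes c x).symm (h.pow_right n)

lemma isAdjointPair_aeval {R V : Type*} [CommRing R] [AddCommGroup V] [Module R V]
    {B : LinearMap.BilinForm R V} {f g : End R V} (h : B.IsAdjointPair B f g) (q : R[X]) :
    B.IsAdjointPair B (aeval f q) (aeval g q) := by
  induction q using Polynomial.induction_on' with
  | add p q hp hq => rw [map_add, map_add]; exact hp.add hq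
  | monomial n c =>
    have hpow : B.IsAdjointPair B (f ^ n : End R V) (g ^ n : End R V) := by
      induction n with
      | zero => exact LinearMap.isAdjointPair_one
      | succ n ih => rw [pow_succ, pow_succ']; exact ih.mul h
    rw [aeval_monomial, aeval_monomial, ← Algebra.smul_def, ← Algebra.smul_def]
    exact hpow.smul c

end Polynomials

/-! ### Endomorphisms with simple imaginary spectrum -/

/-- A basis of eigenvectors of the complexification of `A`, with the pairwise distinct eigenvalues
`± i a μ`, `a μ > 0`; the Boolean component of the index is the sign. -/
structure IsEigenbasis {V ι : Type*} [AddCommGroup V] [Module ℝ V] (A : End ℝ V) (a : ι → ℝ)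
    (b : Basis (ι × Bool) ℂ (ℂ ⊗[ℝ] V)) : Prop where
  pos : ∀ μ, 0 < a μ
  injective : Function.Injective a
  baseChange_apply : ∀ k, A.baseChange ℂ (b k) = signedImag (a k.1) k.2 • b k

lemma signedImag_injective {ι : Type*} {a : ι → ℝ} (ha : ∀ μ, 0 < a μ)
    (hinj : Function.Injective a) :
    Function.Injective fun k : ι × Bool => signedImag (a k.1) k.2 := by
  intro k l h
  have hmem (k : ι × Bool) : (a k.1, k.2) ∈ Set.Ioi (0 : ℝ) ×ˢ (Set.univ : Set Bool) :=
    ⟨ha k.1, Set.mem_univ k.2⟩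
  have hkl := Prod.ext_iff.1 (injOn_signedImag (hmem k) (hmem l) h)
  exact Prod.ext (hinj hkl.1) hkl.2

lemma exists_isEigenbasis_of_hasEigenvalue {V ι : Type*} [AddCommGroup V] [Module ℝ V]
    [FiniteDimensional ℝ V] [Fintype ι] {A : End ℝ V} {a : ι → ℝ}
    (hdim : finrank ℝ V = 2 * Fintype.card ι) (ha : ∀ μ, 0 < a μ) (hinj : Function.Injective a)
    (h : ∀ μ s, End.HasEigenvalue (A.baseChange ℂ) (signedImag (a μ) s)) :
    ∃ b, IsEigenbasis A a b := by
  choose v hv using fun k : ι × Bool => (h k.1 k.2).exists_hasEigenvector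
  have hli : LinearIndependent ℂ v :=
    End.eigenvectors_linearIndependent' _ _ (signedImag_injective ha hinj) v hv
  have hspan : Submodule.span ℂ (Set.range v) = ⊤ :=
    hli.span_eq_top_of_card_eq_finrank' (by
      rw [finrank_baseChange, hdim, Fintype.card_prod, Fintype.card_bool, mul_comm])
  refine ⟨Basis.mk hli hspan.ge, ha, hinj, fun k => ?_⟩
  rw [Basis.mk_apply]
  exact (hv k).apply_eq_smul

namespace IsEigenbasis

open Polynomial

variable {V ι : Type*} [AddCommGroup V] [Module ℝ V] {A : End ℝ V} {a : ι → ℝ}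
  {b : Basis (ι × Bool) ℂ (ℂ ⊗[ℝ] V)}

lemma mem_eigenspace (hb : IsEigenbasis A a b) (k : ι × Bool) :
    b k ∈ End.eigenspace (A.baseChange ℂ) (signedImag (a k.1) k.2) :=
  End.mem_eigenspace_iff.2 (hb.baseChange_apply k)

lemma hasEigenvalue_iff (hb : IsEigenbasis A a b) (z : ℂ) :
    End.HasEigenvalue (A.baseChange ℂ) z ↔ ∃ μ s, signedImag (a μ) s = z :=
  (hasEigenvalue_iff_of_diagonal hb.baseChange_apply z).trans Prod.exists

lemma eigenspace_eq (hb : IsEigenbasis A a b) (k : ι × Bool) :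
    End.eigenspace (A.baseChange ℂ) (signedImag (a k.1) k.2) = ℂ ∙ b k := by
  have hk : {l : ι × Bool | signedImag (a l.1) l.2 = signedImag (a k.1) k.2} = {k} :=
    Set.ext fun l => (signedImag_injective hb.pos hb.injective).eq_iff
  rw [eigenspace_eq_span_of_diagonal hb.baseChange_apply, hk, Set.image_singleton]

lemma eigenspace_eq_span_of_hasEigenvector (hb : IsEigenbasis A a b) {k : ι × Bool} {v : ℂ ⊗[ℝ] V}
    (hv : End.HasEigenvector (A.baseChange ℂ) (signedImag (a k.1) k.2) v) :
    End.eigenspace (A.baseChange ℂ) (signedImag (a k.1) k.2) = ℂ ∙ v := by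
  have hspan := hb.eigenspace_eq k
  obtain ⟨c, rfl⟩ := Submodule.mem_span_singleton.1 (hspan.le hv.1)
  rw [hspan, Submodule.span_singleton_smul_eq (IsUnit.mk0 c (smul_ne_zero_iff.1 hv.2).1)]

lemma exists_eigenspace_le_of_commute (hb : IsEigenbasis A a b) {B : End ℝ V}
    (hAB : Commute A B) {z : ℂ} (hz : End.HasEigenvalue (A.baseChange ℂ) z) :
    ∃ c : ℂ, End.eigenspace (A.baseChange ℂ) z ≤ End.eigenspace (B.baseChange ℂ) c := by
  obtain ⟨μ, s, rfl⟩ := (hb.hasEigenvalue_iff z).1 hz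
  have hspan := hb.eigenspace_eq (μ, s)
  have hmem : B.baseChange ℂ (b (μ, s)) ∈ ℂ ∙ b (μ, s) := by
    rw [← hspan]
    exact End.mapsTo_genEigenspace_of_comm (hAB.map (End.baseChangeHom ℝ ℂ V))
      _ 1 (hb.mem_eigenspace (μ, s))
  obtain ⟨c, hc⟩ := Submodule.mem_span_singleton.1 hmem
  refine ⟨c, hspan.le.trans ?_⟩
  rw [Submodule.span_singleton_le_iff_mem, End.mem_eigenspace_iff]
  exact hc.symm

lemma aeval_charpoly [Fintype ι] [FiniteDimensional ℝ V] (hb : IsEigenbasis A a b) (τ : ℝ) :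
    aeval ((τ : ℂ) * Complex.I) A.charpoly = ((∏ μ, (a μ ^ 2 - τ ^ 2) : ℝ) : ℂ) := by
  rw [← eval_map_algebraMap, ← LinearMap.charpoly_baseChange,
    charpoly_eq_prod_of_diagonal hb.baseChange_apply, eval_prod, Fintype.prod_prod_type,
    Complex.ofReal_prod]
  refine Finset.prod_congr rfl fun μ _ => ?_
  simp only [Fintype.prod_bool, signedImag, eval_sub, eval_X, eval_C, if_true,
    Bool.false_eq_true, if_false]
  push_cast
  linear_combination ((τ : ℂ) ^ 2 - (a μ : ℂ) ^ 2) * Complex.I_sq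

lemma baseChange_aeval_apply (hb : IsEigenbasis A a b) (q : ℝ[X]) (k : ι × Bool) :
    (aeval A q : End ℝ V).baseChange ℂ (b k) = aeval (signedImag (a k.1) k.2) q • b k :=
  baseChange_aeval_apply_of_mem_eigenspace (hb.mem_eigenspace k) q

lemma aeval_eq_aeval (hb : IsEigenbasis A a b) {p q : ℝ[X]}
    (h : ∀ μ s, aeval (signedImag (a μ) s) p = aeval (signedImag (a μ) s) q) :
    (aeval A p : End ℝ V) = aeval A q := by
  apply LinearMap.baseChangeHom_injective (R := ℝ) (M := V) (S := ℂ) (N := V)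
  refine b.ext fun k => ?_
  simp only [LinearMap.baseChangeHom_apply, hb.baseChange_aeval_apply, h]

lemma iSup_eigenspace_eq_span (hb : IsEigenbasis A a b) (s : ι → Bool) :
    ⨆ μ, End.eigenspace (A.baseChange ℂ) (signedImag (a μ) (s μ)) =
      Submodule.span ℂ (Set.range fun μ => b (μ, s μ)) := by
  rw [Submodule.span_range_eq_iSup]
  exact iSup_congr fun μ => hb.eigenspace_eq (μ, s μ)

lemma iSup_eigenspace_injective (hb : IsEigenbasis A a b) :
    Function.Injective fun s : ι → Bool =>
      ⨆ μ, End.eigenspace (A.baseChange ℂ) (signedImag (a μ) (s μ)) := by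
  intro s t hst
  simp only [hb.iSup_eigenspace_eq_span] at hst
  funext μ
  have hmem : b (μ, s μ) ∈ Submodule.span ℂ (b '' Set.range fun ν => (ν, t ν)) := by
    rw [← Set.range_comp, Function.comp_def, ← hst]
    exact Submodule.subset_span ⟨μ, rfl⟩
  simpa [b.mem_span_image, Finsupp.support_single, eq_comm] using hmem

variable [Fintype ι] [DecidableEq ι]

lemma aeval_signPolynomial_sq (hb : IsEigenbasis A a b) (s : ι → Bool) (v : V) :
    aeval A (signPolynomial a s) (aeval A (signPolynomial a s) v) = -v := by
  have hsq : (aeval A (signPolynomial a s * signPolynomial a s) : End ℝ V) =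
      aeval A (-1 : ℝ[X]) := by
    refine hb.aeval_eq_aeval fun μ t => ?_
    rw [map_mul, aeval_signedImag_signPolynomial hb.pos hb.injective]
    split_ifs <;> simp
  simpa using LinearMap.congr_fun hsq v

lemma apply_apply_aeval_pairProjection (hb : IsEigenbasis A a b) (μ : ι) (v : V) :
    A (A (aeval A (pairProjection a μ) v)) = -(a μ ^ 2) • aeval A (pairProjection a μ) v := by
  have hsq : (aeval A (X * (X * pairProjection a μ)) : End ℝ V) =
      aeval A (C (-(a μ ^ 2)) * pairProjection a μ) := by
    refine hb.aeval_eq_aeval fun κ t => ?_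
    have ht := signedImag_sq (a κ) t
    simp only [map_mul, aeval_C, aeval_signedImag_pairProjection hb.pos hb.injective,
      ← mul_assoc, ← sq, Complex.coe_algebraMap]
    split_ifs with h <;> simp [h, ht]
  simpa only [map_mul, aeval_X, aeval_C, End.mul_apply, algebraMap_end_apply]
    using LinearMap.congr_fun hsq v

lemma exists_aeval_pairProjection_ne_zero (hb : IsEigenbasis A a b) (μ : ι) :
    ∃ v, aeval A (pairProjection a μ) v ≠ 0 := by
  by_contra! hzero
  have h := hb.baseChange_aeval_apply (pairProjection a μ) (μ, true)
  rw [show (aeval A (pairProjection a μ) : End ℝ V) = 0 from LinearMap.ext hzero,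
    aeval_signedImag_pairProjection hb.pos hb.injective, if_pos rfl, one_smul] at h
  exact b.ne_zero (μ, true) (by rw [← h]; simp)

/-- A complex eigenvector is recovered from its real part `p`: its imaginary part is `∓ A p / a`. -/
lemma mem_eigenspace_of_pairProjection (hb : IsEigenbasis A a b) (μ : ι) (s : Bool) (v : V) :
    (1 : ℂ) ⊗ₜ[ℝ] aeval A (pairProjection a μ) v +
        Complex.I ⊗ₜ[ℝ] ((if s then -(a μ)⁻¹ else (a μ)⁻¹) • A (aeval A (pairProjection a μ) v)) ∈
      End.eigenspace (A.baseChange ℂ) (signedImag (a μ) s) := by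
  have hne := (hb.pos μ).ne'
  rw [End.mem_eigenspace_iff, baseChange_apply_eq_smul_iff, map_smul,
    hb.apply_apply_aeval_pairProjection, smul_smul, smul_smul]
  cases s <;> simp [signedImag, hne] <;> congr 1 <;> field_simp

lemma eigenspace_aeval_signPolynomial (hb : IsEigenbasis A a b) (s : ι → Bool) :
    End.eigenspace ((aeval A (signPolynomial a s) : End ℝ V).baseChange ℂ) Complex.I =
      ⨆ μ, End.eigenspace (A.baseChange ℂ) (signedImag (a μ) (s μ)) := by
  have hI : -Complex.I ≠ Complex.I := self_ne_neg.2 Complex.I_ne_zero |>.symm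
  rw [eigenspace_eq_span_of_diagonal (hb.baseChange_aeval_apply _), hb.iSup_eigenspace_eq_span]
  congr 1
  ext z
  simp [aeval_signedImag_signPolynomial hb.pos hb.injective, hI]

end IsEigenbasis

section Orthogonal

variable {V : Type*} [NormedAddCommGroup V] [InnerProductSpace ℝ V]

lemma IsEigenbasis.inner_aeval_signPolynomial {ι : Type*} [Fintype ι] [DecidableEq ι]
    {A : End ℝ V} {a : ι → ℝ} {b : Basis (ι × Bool) ℂ (ℂ ⊗[ℝ] V)} (hb : IsEigenbasis A a b)
    (hskew : ∀ v w, inner ℝ (A v) w = -(inner ℝ v (A w) : ℝ)) (s : ι → Bool) (v w : V) :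
    inner ℝ (Polynomial.aeval A (signPolynomial a s) v)
      (Polynomial.aeval A (signPolynomial a s) w) = (inner ℝ v w : ℝ) := by
  have hodd : (Polynomial.aeval (-A) (signPolynomial a s) : End ℝ V) =
      -Polynomial.aeval A (signPolynomial a s) := by
    rw [show -A = Polynomial.aeval A (-Polynomial.X : Polynomial ℝ) by simp,
      ← Polynomial.aeval_comp, ← map_neg]
    refine hb.aeval_eq_aeval fun μ t => ?_
    rw [Polynomial.aeval_comp, map_neg, map_neg, Polynomial.aeval_X, neg_signedImag,
      aeval_signedImag_signPolynomial hb.pos hb.injective,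
      aeval_signedImag_signPolynomial hb.pos hb.injective]
    cases s μ <;> cases t <;> simp
  have hadj : (innerₗ V).IsAdjointPair (innerₗ V) A (-A : End ℝ V) := fun v w => by simp [hskew]
  have h := isAdjointPair_aeval hadj (signPolynomial a s) v
    (Polynomial.aeval A (signPolynomial a s) w)
  rw [hodd] at h
  simpa [hb.aeval_signPolynomial_sq] using h

lemma baseChange_inner_apply_baseChange {S : End ℝ V}
    (hS : ∀ v w, inner ℝ (S v) (S w) = (inner ℝ v w : ℝ)) (y z : ℂ ⊗[ℝ] V) :
    LinearMap.BilinForm.baseChange ℂ (innerₗ V) (S.baseChange ℂ y) (S.baseChange ℂ z) =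
      LinearMap.BilinForm.baseChange ℂ (innerₗ V) y z := by
  induction y using TensorProduct.induction_on with
  | zero => simp
  | add x y hx hy => simp only [map_add, LinearMap.add_apply, hx, hy]
  | tmul c v =>
    induction z using TensorProduct.induction_on with
    | zero => simp
    | add x y hx hy => simp only [map_add, hx, hy]
    | tmul d w =>
      simp only [LinearMap.baseChange_tmul, LinearMap.BilinForm.baseChange_tmul,
        innerₗ_apply_apply, hS]

lemma baseChange_inner_eq_zero_of_mem_eigenspace_I {S : End ℝ V}
    (hS : ∀ v w, inner ℝ (S v) (S w) = (inner ℝ v w : ℝ)) {y z : ℂ ⊗[ℝ] V}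
    (hy : y ∈ End.eigenspace (S.baseChange ℂ) Complex.I)
    (hz : z ∈ End.eigenspace (S.baseChange ℂ) Complex.I) :
    LinearMap.BilinForm.baseChange ℂ (innerₗ V) y z = 0 := by
  have h := baseChange_inner_apply_baseChange hS y z
  rw [End.mem_eigenspace_iff.1 hy, End.mem_eigenspace_iff.1 hz, map_smul, map_smul,
    LinearMap.smul_apply, smul_smul, Complex.I_mul_I, neg_one_smul] at h
  exact self_eq_neg.1 h.symm

end Orthogonal

/-! ### Tensor fields in coordinates -/

section Coordinates

variable {E : Type*} [NormedAddCommGroup E] [NormedSpace ℝ E]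
  {M : Type*} [TopologicalSpace M] [ChartedSpace E M] [IsManifold 𝓘(ℝ, E) ∞ M]

/-- A field of bilinear forms is a smooth section of the bundle of bilinear forms on `TM`. -/
def IsSmoothBilin (β : BilinField E M) : Prop :=
  ContMDiff 𝓘(ℝ, E) (𝓘(ℝ, E).prod 𝓘(ℝ, E →L[ℝ] E →L[ℝ] ℝ)) ∞
    (fun x => TotalSpace.mk' (E →L[ℝ] E →L[ℝ] ℝ)
      (E := fun x : M => TangentSpace 𝓘(ℝ, E) x →L[ℝ] TangentSpace 𝓘(ℝ, E) x →L[ℝ] ℝ) x (β x))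

variable (E) in
/-- The domain of the trivialization of the tangent bundle centered at `x₀`. -/
def coordSet (x₀ : M) : Set M :=
  (trivializationAt E (TangentSpace 𝓘(ℝ, E) : M → Type _) x₀).baseSet

variable (E) in
lemma coordSet_mem_nhds (x₀ : M) : coordSet E x₀ ∈ nhds x₀ :=
  (trivializationAt E (TangentSpace 𝓘(ℝ, E) : M → Type _) x₀).open_baseSet.mem_nhds
    (FiberBundle.mem_baseSet_trivializationAt' x₀)

/-- The trivialization centered at `x₀`, as an identification of the tangent space at `x` with the
model space. -/
noncomputable def coordEquiv {x₀ x : M} (hx : x ∈ coordSet E x₀) : TangentSpace 𝓘(ℝ, E) x ≃L[ℝ] E :=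
  (trivializationAt E (TangentSpace 𝓘(ℝ, E) : M → Type _) x₀).continuousLinearEquivAt ℝ x hx

/-- The expression of an endomorphism of the tangent space at `x` in the trivialization centered at
`x₀`. -/
noncomputable def endCoord (x₀ x : M)
    (B : TangentSpace 𝓘(ℝ, E) x →L[ℝ] TangentSpace 𝓘(ℝ, E) x) : E →L[ℝ] E :=
  ContinuousLinearMap.inCoordinates E (TangentSpace 𝓘(ℝ, E) : M → Type _)
    E (TangentSpace 𝓘(ℝ, E) : M → Type _) x₀ x x₀ x B

/-- The expression of a bilinear form on the tangent space at `x` in the trivialization centered at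
`x₀`. -/
noncomputable def bilinCoord (x₀ x : M)
    (β : TangentSpace 𝓘(ℝ, E) x →L[ℝ] TangentSpace 𝓘(ℝ, E) x →L[ℝ] ℝ) : E →L[ℝ] E →L[ℝ] ℝ :=
  ContinuousLinearMap.inCoordinates E (TangentSpace 𝓘(ℝ, E) : M → Type _)
    (E →L[ℝ] ℝ) (fun x : M => TangentSpace 𝓘(ℝ, E) x →L[ℝ] Bundle.Trivial M ℝ x) x₀ x x₀ x β

lemma endCoord_apply {x₀ x : M} (hx : x ∈ coordSet E x₀)
    (B : TangentSpace 𝓘(ℝ, E) x →L[ℝ] TangentSpace 𝓘(ℝ, E) x) (v : E) :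
    endCoord x₀ x B v = coordEquiv hx (B ((coordEquiv hx).symm v)) := by
  rw [endCoord, ContinuousLinearMap.inCoordinates_eq hx hx]
  rfl

lemma bilinCoord_apply {x₀ x : M} (hx : x ∈ coordSet E x₀)
    (β : TangentSpace 𝓘(ℝ, E) x →L[ℝ] TangentSpace 𝓘(ℝ, E) x →L[ℝ] ℝ) (v w : E) :
    bilinCoord x₀ x β v w = β ((coordEquiv hx).symm v) ((coordEquiv hx).symm w) := by
  rw [bilinCoord, inCoordinates_apply_eq₂ hx hx (Set.mem_univ _)]
  simp only [Trivial.fiberBundle_trivializationAt', Trivial.linearMapAt_trivialization,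
    LinearMap.id_coe, id_eq]
  rfl

lemma isSmoothEnd_iff_endCoord {J : EndField E M} : IsSmoothEnd J ↔
    ∀ x₀, ContMDiffAt 𝓘(ℝ, E) 𝓘(ℝ, E →L[ℝ] E) ∞ (fun x => endCoord x₀ x (J x)) x₀ :=
  forall_congr' fun _ => (contMDiffAt_hom_bundle _).trans (and_iff_right contMDiffAt_id)

lemma isSmoothBilin_iff_bilinCoord {β : BilinField E M} : IsSmoothBilin β ↔
    ∀ x₀, ContMDiffAt 𝓘(ℝ, E) 𝓘(ℝ, E →L[ℝ] E →L[ℝ] ℝ) ∞ (fun x => bilinCoord x₀ x (β x)) x₀ :=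
  forall_congr' fun _ => (contMDiffAt_hom_bundle _).trans (and_iff_right contMDiffAt_id)

lemma isSmoothEnd_of_endCoord {J : EndField E M} (f : M → M → E →L[ℝ] E)
    (hf : ∀ x₀, ContMDiffAt 𝓘(ℝ, E) 𝓘(ℝ, E →L[ℝ] E) ∞ (f x₀) x₀)
    (hfJ : ∀ x₀, ∀ x ∈ coordSet E x₀, f x₀ x = endCoord x₀ x (J x)) : IsSmoothEnd J :=
  isSmoothEnd_iff_endCoord.2 fun x₀ => (hf x₀).congr_of_eventuallyEq <| by
    filter_upwards [coordSet_mem_nhds E x₀] with x hx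
    exact (hfJ x₀ x hx).symm

lemma isSmoothBilin_of_bilinCoord {β : BilinField E M} (f : M → M → E →L[ℝ] E →L[ℝ] ℝ)
    (hf : ∀ x₀, ContMDiffAt 𝓘(ℝ, E) 𝓘(ℝ, E →L[ℝ] E →L[ℝ] ℝ) ∞ (f x₀) x₀)
    (hfβ : ∀ x₀, ∀ x ∈ coordSet E x₀, f x₀ x = bilinCoord x₀ x (β x)) : IsSmoothBilin β :=
  isSmoothBilin_iff_bilinCoord.2 fun x₀ => (hf x₀).congr_of_eventuallyEq <| by
    filter_upwards [coordSet_mem_nhds E x₀] with x hx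
    exact (hfβ x₀ x hx).symm

namespace IsSmoothEnd

variable {J K : EndField E M}

lemma comp (hJ : IsSmoothEnd J) (hK : IsSmoothEnd K) : IsSmoothEnd fun x => (J x).comp (K x) :=
  isSmoothEnd_of_endCoord _
    (fun x₀ => (isSmoothEnd_iff_endCoord.1 hJ x₀).clm_comp (isSmoothEnd_iff_endCoord.1 hK x₀))
    fun x₀ x hx => by ext v; simp [endCoord_apply hx]

lemma add (hJ : IsSmoothEnd J) (hK : IsSmoothEnd K) : IsSmoothEnd fun x => J x + K x :=
  isSmoothEnd_of_endCoord _
    (fun x₀ => (isSmoothEnd_iff_endCoord.1 hJ x₀).add (isSmoothEnd_iff_endCoord.1 hK x₀))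
    fun x₀ x hx => by ext v; simp [endCoord_apply hx]

lemma smul {f : M → ℝ} (hf : ContMDiff 𝓘(ℝ, E) 𝓘(ℝ, ℝ) ∞ f) (hJ : IsSmoothEnd J) :
    IsSmoothEnd fun x => f x • J x :=
  isSmoothEnd_of_endCoord _
    (fun x₀ => (hf x₀).smul (isSmoothEnd_iff_endCoord.1 hJ x₀))
    fun x₀ x hx => by ext v; simp [endCoord_apply hx]

lemma contMDiffAt_app (hJ : IsSmoothEnd J) {X : VField E M} {x : M} (hX : CMDiffAt ∞ (T% X) x) :
    CMDiffAt ∞ (T% (J.app X)) x :=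
  ContMDiffAt.clm_bundle_apply (hJ x) hX

lemma mdifferentiableAt_app (hJ : IsSmoothEnd J) {X : VField E M} {x : M}
    (hX : MDiffAt (T% X) x) : MDiffAt (T% (J.app X)) x :=
  MDifferentiableAt.clm_bundle_apply ((hJ x).mdifferentiableAt (by simp)) hX

end IsSmoothEnd

lemma isSmoothEnd_id :
    IsSmoothEnd fun x : M => ContinuousLinearMap.id ℝ (TangentSpace 𝓘(ℝ, E) x) :=
  isSmoothEnd_of_endCoord (fun _ _ => ContinuousLinearMap.id ℝ E) (fun _ => contMDiffAt_const)
    fun x₀ x hx => by ext v; simp [endCoord_apply hx]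

namespace IsSmoothBilin

variable {β γ : BilinField E M}

lemma sub (hβ : IsSmoothBilin β) (hγ : IsSmoothBilin γ) : IsSmoothBilin fun x => β x - γ x :=
  isSmoothBilin_of_bilinCoord _
    (fun x₀ => (isSmoothBilin_iff_bilinCoord.1 hβ x₀).sub (isSmoothBilin_iff_bilinCoord.1 hγ x₀))
    fun x₀ x hx => by ext v w; simp [bilinCoord_apply hx]

lemma smul {f : M → ℝ} (hf : ContMDiff 𝓘(ℝ, E) 𝓘(ℝ, ℝ) ∞ f) (hβ : IsSmoothBilin β) :
    IsSmoothBilin fun x => f x • β x :=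
  isSmoothBilin_of_bilinCoord (fun x₀ x => f x • bilinCoord x₀ x (β x))
    (fun x₀ => (hf x₀).smul (isSmoothBilin_iff_bilinCoord.1 hβ x₀))
    fun x₀ x hx => by ext v w; simp [bilinCoord_apply hx]

lemma comp {J : EndField E M} (hβ : IsSmoothBilin β) (hJ : IsSmoothEnd J) :
    IsSmoothBilin fun x => (β x).comp (J x) :=
  isSmoothBilin_of_bilinCoord _
    (fun x₀ => (isSmoothBilin_iff_bilinCoord.1 hβ x₀).clm_comp (isSmoothEnd_iff_endCoord.1 hJ x₀))
    fun x₀ x hx => by ext v w; simp [bilinCoord_apply hx, endCoord_apply hx]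

end IsSmoothBilin

lemma IsTwoForm.neg_apply {β : BilinField E M} (hβ : IsTwoForm β) {x : M}
    (v w : TangentSpace 𝓘(ℝ, E) x) : -β x v w = β x w v := by
  have h := hβ.alt x (v + w)
  simp only [map_add, _root_.add_apply, hβ.alt] at h
  linarith

lemma isInvertible_of_apply_self_eq_zero [FiniteDimensional ℝ E] {G : E →L[ℝ] E →L[ℝ] ℝ}
    (hG : ∀ v, G v v = 0 → v = 0) : G.IsInvertible := by
  have hinj : Function.Injective G :=
    (injective_iff_map_eq_zero G).2 fun v hv => hG v (by rw [hv, _root_.zero_apply])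
  have hrank : finrank ℝ E = finrank ℝ (E →L[ℝ] ℝ) := by
    rw [← LinearMap.toContinuousLinearMap.finrank_eq]
    exact Subspace.dual_finrank_eq.symm
  exact ⟨(LinearEquiv.ofInjectiveOfFinrankEq (G : E →ₗ[ℝ] E →L[ℝ] ℝ)
    hinj hrank).toContinuousLinearEquiv, rfl⟩

end Coordinates

section MetricCoordinates

variable {E : Type*} [NormedAddCommGroup E] [NormedSpace ℝ E]
  {M : Type*} [TopologicalSpace M] [ChartedSpace E M] [IsManifold 𝓘(ℝ, E) ∞ M]
  [RiemannianBundle (fun x : M => TangentSpace 𝓘(ℝ, E) x)]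

variable (E M) in
/-- The metric as a field of bilinear forms. -/
noncomputable def metricForm : BilinField E M := fun _ => innerSL ℝ

lemma bilinCoord_metricForm_apply {x₀ x : M} (hx : x ∈ coordSet E x₀) (v w : E) :
    bilinCoord x₀ x (metricForm E M x) v w =
      inner ℝ ((coordEquiv hx).symm v) ((coordEquiv hx).symm w) :=
  bilinCoord_apply hx _ v w

lemma IsTwoForm.bilinCoord_metricForm_comp_endCoord_sharp [FiniteDimensional ℝ E]
    {β : BilinField E M} (hβ : IsTwoForm β) {x₀ x : M} (hx : x ∈ coordSet E x₀) :
    (bilinCoord x₀ x (metricForm E M x)).comp (endCoord x₀ x (sharp β x)) =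
      -bilinCoord x₀ x (β x) := by
  ext v w
  change _ = -bilinCoord x₀ x (β x) v w
  rw [bilinCoord_apply hx, ContinuousLinearMap.comp_apply,
    bilinCoord_metricForm_apply hx, endCoord_apply hx, ContinuousLinearEquiv.symm_apply_apply,
    real_inner_comm, inner_sharp, hβ.neg_apply]

lemma isInvertible_bilinCoord_metricForm [FiniteDimensional ℝ E] {x₀ x : M}
    (hx : x ∈ coordSet E x₀) : (bilinCoord x₀ x (metricForm E M x)).IsInvertible :=
  isInvertible_of_apply_self_eq_zero fun v hv => by
    rwa [bilinCoord_metricForm_apply hx, inner_self_eq_zero,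
      map_eq_zero_iff _ (coordEquiv hx).symm.injective] at hv

variable [IsContMDiffRiemannianBundle 𝓘(ℝ, E) ∞ E (fun x : M => TangentSpace 𝓘(ℝ, E) x)]

variable (E M) in
lemma isSmoothBilin_metricForm : IsSmoothBilin (metricForm E M) := by
  obtain ⟨g, hg, hgi⟩ := IsContMDiffRiemannianBundle.exists_contMDiff (IB := 𝓘(ℝ, E)) (n := ∞)
    (F := E) (E := fun x : M => TangentSpace 𝓘(ℝ, E) x)
  have heq : metricForm E M = g := by
    ext x v w
    exact hgi x v w
  rwa [heq]

lemma IsSmoothEnd.isSmoothBilin_fundForm {J : EndField E M} (hJ : IsSmoothEnd J) :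
    IsSmoothBilin (fundForm J) :=
  (isSmoothBilin_metricForm E M).comp hJ

lemma IsTwoForm.shiftedForm [FiniteDimensional ℝ E] {J : EndField E M} {ψ : BilinField E M}
    {σ : M → ℝ} (hJ : IsSmoothEnd J) (hJs : ∀ x v, inner ℝ (J x v) v = (0 : ℝ)) (hψ : IsTwoForm ψ)
    (hσ : ContMDiff 𝓘(ℝ, E) 𝓘(ℝ, ℝ) ∞ σ) : IsTwoForm (shiftedForm J ψ σ) where
  smooth := by
    have hσ2 : ContMDiff 𝓘(ℝ, E) 𝓘(ℝ, ℝ) ∞ fun x => σ x / 2 :=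
      (contDiff_id.div_const 2).contMDiff.comp hσ
    exact IsSmoothBilin.sub hψ.smooth (hJ.isSmoothBilin_fundForm.smul hσ2)
  alt x v := by simp [HamiltonianForms.shiftedForm, hψ.alt, fundForm_apply, hJs]

lemma IsTwoForm.isSmoothEnd_sharp [FiniteDimensional ℝ E] {β : BilinField E M}
    (hβ : IsTwoForm β) :
    IsSmoothEnd (sharp β) := by
  refine isSmoothEnd_of_endCoord (fun x₀ x => (bilinCoord x₀ x (metricForm E M x)).inverse.comp
    (-bilinCoord x₀ x (β x))) (fun x₀ => ContMDiffAt.clm_comp ?_ ?_) fun x₀ x hx => ?_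
  · have hx₀ := mem_of_mem_nhds (coordSet_mem_nhds E x₀)
    exact (isInvertible_bilinCoord_metricForm hx₀).contDiffAt_map_inverse.contMDiffAt.comp x₀
      (isSmoothBilin_iff_bilinCoord.1 (isSmoothBilin_metricForm E M) x₀)
  · exact (isSmoothBilin_iff_bilinCoord.1 hβ.smooth x₀).neg
  · obtain ⟨e, he⟩ := isInvertible_bilinCoord_metricForm hx
    rw [← hβ.bilinCoord_metricForm_comp_endCoord_sharp hx, ← he, ContinuousLinearMap.inverse_equiv]
    ext v
    simp

end MetricCoordinates

/-! ### Smooth dependence of imaginary eigenvalues -/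

section ImplicitRoots

lemma isInvertible_of_apply_one_ne_zero {f : ℝ →L[ℝ] ℝ} (h : f 1 ≠ 0) : f.IsInvertible := by
  refine ⟨ContinuousLinearEquiv.smulLeft (Units.mk0 _ h), ?_⟩
  ext
  simp

lemma exists_contDiffAt_implicit {P : Type*} [NormedAddCommGroup P] [NormedSpace ℝ P]
    [CompleteSpace P] {F : P × ℝ → ℝ} {p : P} {c d : ℝ} (hF : ContDiffAt ℝ ∞ F (p, c))
    (hderiv : HasDerivAt (fun τ => F (p, τ)) d c) (hd : d ≠ 0) :
    ∃ r : P → ℝ, ContDiffAt ℝ ∞ r p ∧ r p = c ∧ ∀ᶠ q in nhds p, F (q, r q) = F (p, c) := by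
  have hpartial : (fderiv ℝ F (p, c) ∘L .inr ℝ P ℝ) 1 = d :=
    ((hF.differentiableAt (by simp)).hasFDerivAt.comp_hasDerivAt c
      ((hasDerivAt_const c p).prodMk (hasDerivAt_id c))).unique hderiv
  have hinv := isInvertible_of_apply_one_ne_zero (hpartial.trans_ne hd)
  exact ⟨hF.implicitFunction (by simp) hinv, hF.contDiffAt_implicitFunction (by simp) hinv,
    hF.implicitFunction_apply_self (by simp) hinv,
    hF.eventually_apply_implicitFunction (by simp) hinv⟩

variable {ι : Type*} [Fintype ι]

lemma exists_eq_of_prod_sq_sub_sq_eq_zero {c : ι → ℝ} (hpos : ∀ μ, 0 < c μ) {τ : ℝ} (hτ : 0 < τ)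
    (h : ∏ μ, (c μ ^ 2 - τ ^ 2) = 0) : ∃ μ, τ = c μ := by
  obtain ⟨μ, -, hμ⟩ := Finset.prod_eq_zero_iff.1 h
  exact ⟨μ, (pow_left_inj₀ hτ.le (hpos μ).le two_ne_zero).1 (sub_eq_zero.1 hμ).symm⟩

variable [DecidableEq ι]

lemma hasDerivAt_prod_sq_sub_sq (c : ι → ℝ) (μ : ι) :
    HasDerivAt (fun τ : ℝ => ∏ ν, (c ν ^ 2 - τ ^ 2))
      (-(2 * c μ) * ∏ ν ∈ Finset.univ.erase μ, (c ν ^ 2 - c μ ^ 2)) (c μ) := by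
  have hfactor : HasDerivAt (fun τ : ℝ => c μ ^ 2 - τ ^ 2) (-(2 * c μ)) (c μ) := by
    simpa using (hasDerivAt_pow 2 (c μ)).const_sub (c μ ^ 2)
  have hrest : DifferentiableAt ℝ
      (fun τ : ℝ => ∏ ν ∈ Finset.univ.erase μ, (c ν ^ 2 - τ ^ 2)) (c μ) := by
    fun_prop
  have hprod := hfactor.mul hrest.hasDerivAt
  rw [sub_self, zero_mul, add_zero] at hprod
  refine hprod.congr_of_eventuallyEq (Filter.Eventually.of_forall fun τ => ?_)
  exact (Finset.mul_prod_erase _ (fun ν => c ν ^ 2 - τ ^ 2) (Finset.mem_univ μ)).symm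

lemma prod_erase_sq_sub_sq_ne_zero {c : ι → ℝ} (hpos : ∀ μ, 0 < c μ)
    (hinj : Function.Injective c) (μ : ι) :
    -(2 * c μ) * ∏ ν ∈ Finset.univ.erase μ, (c ν ^ 2 - c μ ^ 2) ≠ 0 := by
  refine mul_ne_zero (by linarith [hpos μ]) (Finset.prod_ne_zero_iff.2 fun ν hν => ?_)
  rw [sub_ne_zero, Ne, pow_left_inj₀ (hpos ν).le (hpos μ).le two_ne_zero]
  exact hinj.ne (Finset.ne_of_mem_erase hν)

lemma eq_of_strictMono_of_forall_exists {m : ℕ} {c d : Fin m → ℝ} (hc : StrictMono c)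
    (hd : StrictMono d) (h : ∀ μ, ∃ ν, d μ = c ν) : d = c := by
  choose f hf using h
  have hmono : StrictMono f := fun μ ν hμν =>
    hc.lt_iff_lt.1 (by simpa only [hf] using hd hμν)
  funext μ
  rw [hf, le_antisymm hmono.apply_le hmono.le_apply]

lemma eventually_strictMono {X : Type*} [TopologicalSpace X] {m : ℕ} {r : Fin m → X → ℝ} {x₀ : X}
    (hr : ∀ ν, ContinuousAt (r ν) x₀) (hx₀ : StrictMono fun ν => r ν x₀) :
    ∀ᶠ x in nhds x₀, StrictMono fun ν => r ν x := by
  refine Filter.eventually_all.2 fun ν => Filter.eventually_all.2 fun κ => ?_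
  by_cases h : ν < κ
  · filter_upwards [(hr ν).eventually_lt (hr κ) (hx₀ h)] with x hx _ using hx
  · exact Filter.Eventually.of_forall fun x h' => absurd h' h

end ImplicitRoots

section SmoothEigenvalues

variable {E : Type*} [NormedAddCommGroup E] [NormedSpace ℝ E] [FiniteDimensional ℝ E]

/-- The real part of the characteristic polynomial of `B` at `τ i`, as a function of `(B, τ)`. Its
positive zeros in `τ` are the positive imaginary parts of the eigenvalues when all of these are
imaginary and come in conjugate pairs, which is how they are shown to be smooth. -/
noncomputable def imagCharpoly (p : (E →L[ℝ] E) × ℝ) : ℝ :=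
  (Polynomial.aeval ((p.2 : ℂ) * Complex.I) (p.1 : E →ₗ[ℝ] E).charpoly).re

lemma imagCharpoly_eq_sum (b : Basis (Fin (finrank ℝ E)) ℝ E) (p : (E →L[ℝ] E) × ℝ) :
    imagCharpoly p = (∑ g : Equiv.Perm (Fin (finrank ℝ E)), ((Equiv.Perm.sign g : ℤ) : ℂ) *
      ∏ i, ((if g i = i then (p.2 : ℂ) * Complex.I else 0) -
        ((b.coord (g i) (p.1 (b i)) : ℝ) : ℂ))).re := by
  rw [imagCharpoly, ← Polynomial.eval_map_algebraMap, ← LinearMap.charpoly_toMatrix _ b,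
    ← Matrix.charpoly_map, Matrix.eval_charpoly, Matrix.det_apply']
  congr! with g _ i
  simp [LinearMap.toMatrix_apply, Matrix.diagonal_apply]

lemma contDiff_imagCharpoly : ContDiff ℝ ∞ (imagCharpoly (E := E)) := by
  rw [funext (imagCharpoly_eq_sum (finBasis ℝ E))]
  refine Complex.reCLM.contDiff.comp (ContDiff.sum fun g _ => contDiff_const.mul
    (contDiff_prod fun i _ => ContDiff.sub ?_ (Complex.ofRealCLM.contDiff.comp ?_)))
  · split_ifs
    · exact (Complex.ofRealCLM.contDiff.comp contDiff_snd).mul contDiff_const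
    · exact contDiff_const
  · exact (LinearMap.toContinuousLinearMap ((finBasis ℝ E).coord (g i))).contDiff.comp
      (contDiff_fst.clm_apply contDiff_const)

lemma exists_contDiffAt_imagCharpoly_eq_zero {ι : Type*} [Fintype ι] {B₀ : E →L[ℝ] E} {c : ι → ℝ}
    (hpos : ∀ μ, 0 < c μ) (hinj : Function.Injective c)
    (hB : ∀ τ, imagCharpoly (B₀, τ) = ∏ μ, (c μ ^ 2 - τ ^ 2)) (μ : ι) :
    ∃ r : (E →L[ℝ] E) → ℝ, ContDiffAt ℝ ∞ r B₀ ∧ r B₀ = c μ ∧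
      ∀ᶠ B in nhds B₀, imagCharpoly (B, r B) = 0 := by
  classical
  have hzero : imagCharpoly (B₀, c μ) = 0 :=
    (hB _).trans (Finset.prod_eq_zero (Finset.mem_univ μ) (sub_self _))
  rw [← hzero]
  refine exists_contDiffAt_implicit contDiff_imagCharpoly.contDiffAt ?_
    (prod_erase_sq_sub_sq_ne_zero hpos hinj μ)
  rw [funext hB]
  exact hasDerivAt_prod_sq_sub_sq c μ

variable {M : Type*} [TopologicalSpace M] [ChartedSpace E M] [IsManifold 𝓘(ℝ, E) ∞ M]

lemma imagCharpoly_endCoord {x₀ x : M} (hx : x ∈ coordSet E x₀)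
    (B : TangentSpace 𝓘(ℝ, E) x →L[ℝ] TangentSpace 𝓘(ℝ, E) x) (τ : ℝ) :
    imagCharpoly (endCoord x₀ x B, τ) = (Polynomial.aeval ((τ : ℂ) * Complex.I)
      (LinearMap.charpoly (M := TangentSpace 𝓘(ℝ, E) x) B.toLinearMap)).re := by
  have hconj : (endCoord x₀ x B : E →ₗ[ℝ] E) =
      (coordEquiv hx).toLinearEquiv.conj B.toLinearMap := by
    ext v
    exact endCoord_apply hx B v
  rw [imagCharpoly, hconj, LinearEquiv.charpoly_conj]

lemma IsSmoothEnd.contMDiff_of_aeval_charpoly {m : ℕ} {B : EndField E M} (hB : IsSmoothEnd B)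
    {a : Fin m → M → ℝ} (hpos : ∀ x μ, 0 < a μ x) (hmono : ∀ x, StrictMono fun μ => a μ x)
    (hchar : ∀ x (τ : ℝ), Polynomial.aeval ((τ : ℂ) * Complex.I)
      (LinearMap.charpoly (M := TangentSpace 𝓘(ℝ, E) x) (B x).toLinearMap) =
        ((∏ μ, (a μ x ^ 2 - τ ^ 2) : ℝ) : ℂ)) (μ : Fin m) :
    ContMDiff 𝓘(ℝ, E) 𝓘(ℝ, ℝ) ∞ (a μ) := by
  intro x₀
  have himag : ∀ x ∈ coordSet E x₀, ∀ τ : ℝ,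
      imagCharpoly (endCoord x₀ x (B x), τ) = ∏ μ, (a μ x ^ 2 - τ ^ 2) := fun x hx τ => by
    rw [imagCharpoly_endCoord hx, hchar, Complex.ofReal_re]
  have hcoord := isSmoothEnd_iff_endCoord.1 hB x₀
  choose r hr hr₀ hroot using exists_contDiffAt_imagCharpoly_eq_zero (hpos x₀)
    (hmono x₀).injective (himag x₀ (mem_of_mem_nhds (coordSet_mem_nhds E x₀)))
  have hsmooth (ν : Fin m) :
      ContMDiffAt 𝓘(ℝ, E) 𝓘(ℝ, ℝ) ∞ (fun x => r ν (endCoord x₀ x (B x))) x₀ :=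
    (hr ν).contMDiffAt.comp x₀ hcoord
  have hrpos : ∀ᶠ x in nhds x₀, ∀ ν, 0 < r ν (endCoord x₀ x (B x)) :=
    Filter.eventually_all.2 fun ν => (hsmooth ν).continuousAt.eventually
      (lt_mem_nhds ((hpos x₀ ν).trans_eq (hr₀ ν).symm))
  have hrmono : ∀ᶠ x in nhds x₀, StrictMono fun ν => r ν (endCoord x₀ x (B x)) :=
    eventually_strictMono (fun ν => (hsmooth ν).continuousAt) (by simpa only [hr₀] using hmono x₀)
  have hrzero : ∀ᶠ x in nhds x₀, ∀ ν,
      imagCharpoly (endCoord x₀ x (B x), r ν (endCoord x₀ x (B x))) = 0 :=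
    Filter.eventually_all.2 fun ν => hcoord.continuousAt.eventually (hroot ν)
  refine (hsmooth μ).congr_of_eventuallyEq ?_
  filter_upwards [hrpos, hrmono, hrzero, coordSet_mem_nhds E x₀] with x hpos' hmono' hzero hx
  refine congrFun (eq_of_strictMono_of_forall_exists (hmono x) hmono' fun ν => ?_).symm μ
  exact exists_eq_of_prod_sq_sub_sq_eq_zero (hpos x) (hpos' ν)
    ((himag x hx _).symm.trans (hzero ν))

end SmoothEigenvalues

/-! ### Covariant derivatives of endomorphism fields -/

section Connection

variable {E : Type*} [NormedAddCommGroup E] [NormedSpace ℝ E]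
  {M : Type*} [TopologicalSpace M] [ChartedSpace E M] [IsManifold 𝓘(ℝ, E) ∞ M]

lemma exists_mdifferentiableAt_eq {x : M} (w : TangentSpace 𝓘(ℝ, E) x) :
    ∃ X : VField E M, MDiffAt (T% X) x ∧ X x = w :=
  ⟨FiberBundle.extend E w, FiberBundle.mdifferentiableAt_extend .., by simp⟩

variable (cov : CovariantDerivative 𝓘(ℝ, E) E (fun x : M => TangentSpace 𝓘(ℝ, E) x))

lemma IsSmoothEnd.tensorialAt_cov_app_sub {B : EndField E M} (hB : IsSmoothEnd B) (x : M) :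
    TensorialAt 𝓘(ℝ, E) E
      (fun X : VField E M => cov (B.app X) x - (B x).comp (cov X x)) x where
  smul {f X} hf hX := by
    have happ : B.app (f • X) = f • B.app X := by
      funext y
      simp [EndField.app]
    rw [happ, cov.isCovariantDerivativeOnUniv.leibniz hX hf,
      cov.isCovariantDerivativeOnUniv.leibniz (hB.mdifferentiableAt_app hX) hf]
    ext v
    simp [EndField.app, smul_sub]
  add {X Y} hX hY := by
    have happ : B.app (X + Y) = B.app X + B.app Y := by
      funext y
      simp [EndField.app]
    rw [happ, cov.isCovariantDerivativeOnUniv.add hX hY, cov.isCovariantDerivativeOnUniv.add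
      (hB.mdifferentiableAt_app hX) (hB.mdifferentiableAt_app hY), ContinuousLinearMap.comp_add,
      add_sub_add_comm]

variable [FiniteDimensional ℝ E]

/-- The covariant derivative `∇B` of a field of endomorphisms. The differentiated direction is the
last argument: `covEnd cov hB x w v` is `(∇_v B) w`. -/
noncomputable def covEnd {B : EndField E M} (hB : IsSmoothEnd B) (x : M) :
    TangentSpace 𝓘(ℝ, E) x →L[ℝ] TangentSpace 𝓘(ℝ, E) x →L[ℝ] TangentSpace 𝓘(ℝ, E) x :=
  TensorialAt.mkHom _ x (hB.tensorialAt_cov_app_sub cov x)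

variable {cov}

lemma covEnd_apply {B : EndField E M} (hB : IsSmoothEnd B) {x : M} {X : VField E M}
    (hX : MDiffAt (T% X) x) (v : TangentSpace 𝓘(ℝ, E) x) :
    covEnd cov hB x (X x) v = cov (B.app X) x v - B x (cov X x v) := by
  rw [covEnd, TensorialAt.mkHom_apply _ hX]
  rfl

lemma covEnd_apply_add_apply_covEnd {A B : EndField E M} (hA : IsSmoothEnd A) (hB : IsSmoothEnd B)
    (h : ∀ x v, A x (B x v) = B x (A x v)) {x : M} (w v : TangentSpace 𝓘(ℝ, E) x) :
    covEnd cov hA x (B x w) v + A x (covEnd cov hB x w v) =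
      covEnd cov hB x (A x w) v + B x (covEnd cov hA x w v) := by
  obtain ⟨X, hX, rfl⟩ := exists_mdifferentiableAt_eq w
  have hAB := covEnd_apply (cov := cov) hA (hB.mdifferentiableAt_app hX) v
  have hBA := covEnd_apply (cov := cov) hB (hA.mdifferentiableAt_app hX) v
  have happ : A.app (B.app X) = B.app (A.app X) := funext fun y => h y (X y)
  simp only [EndField.app] at hAB hBA happ
  rw [hAB, hBA, covEnd_apply hA hX, covEnd_apply hB hX, map_sub, map_sub, h]
  simp only [happ]
  abel

lemma covEnd_apply_of_sq {J : EndField E M} (hJ : IsSmoothEnd J) (h : ∀ x v, J x (J x v) = -v)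
    {x : M} (w v : TangentSpace 𝓘(ℝ, E) x) :
    covEnd cov hJ x (J x w) v = -J x (covEnd cov hJ x w v) := by
  obtain ⟨X, hX, rfl⟩ := exists_mdifferentiableAt_eq w
  have hJJ := covEnd_apply (cov := cov) hJ (hJ.mdifferentiableAt_app hX) v
  have happ : J.app (J.app X) = (-1 : ℝ) • X := funext fun y => (h y (X y)).trans (by simp)
  rw [happ, cov.isCovariantDerivativeOnUniv.smul_const _ hX] at hJJ
  simp only [EndField.app] at hJJ
  rw [hJJ, covEnd_apply hJ hX, map_sub, h]
  simp [sub_eq_add_neg]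

lemma nijenhuis_eq_covEnd (htor : cov.torsion = 0) {J : EndField E M} (hJ : IsSmoothEnd J)
    (h : ∀ x v, J x (J x v) = -v) {x : M} {X Y : VField E M} (hX : MDiffAt (T% X) x)
    (hY : MDiffAt (T% Y) x) :
    mlieBracket 𝓘(ℝ, E) (J.app X) (J.app Y) x
      - J x (mlieBracket 𝓘(ℝ, E) (J.app X) Y x)
      - J x (mlieBracket 𝓘(ℝ, E) X (J.app Y) x)
      - mlieBracket 𝓘(ℝ, E) X Y x =
    covEnd cov hJ x (Y x) (J x (X x)) - covEnd cov hJ x (X x) (J x (Y x))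
      + J x (covEnd cov hJ x (X x) (Y x)) - J x (covEnd cov hJ x (Y x) (X x)) := by
  have hbracket {X Y : VField E M} : MDiffAt (T% X) x → MDiffAt (T% Y) x →
      cov Y x (X x) - cov X x (Y x) = mlieBracket 𝓘(ℝ, E) X Y x :=
    (CovariantDerivative.torsion_eq_zero_iff cov).1 htor
  have hJX := hJ.mdifferentiableAt_app hX
  have hJY := hJ.mdifferentiableAt_app hY
  rw [← hbracket hJX hJY, ← hbracket hJX hY, ← hbracket hX hJY, ← hbracket hX hY,
    covEnd_apply hJ hX, covEnd_apply hJ hX, covEnd_apply hJ hY, covEnd_apply hJ hY]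
  simp only [map_sub, h, EndField.app]
  abel

lemma isComplexStructure_of_covEnd (htor : cov.torsion = 0) {J : EndField E M}
    (hJ : IsSmoothEnd J) (h : ∀ x v, J x (J x v) = -v)
    (hcovJ : ∀ x w v, covEnd cov hJ x w (J x v) = J x (covEnd cov hJ x w v)) :
    IsComplexStructure J where
  smooth := hJ
  sq := h
  integrable x X Y hX hY := by
    rw [nijenhuis_eq_covEnd htor hJ h hX hY, hcovJ, hcovJ]
    abel

lemma extDeriv₂_eq_covDeriv₂ (htor : cov.torsion = 0) {β : BilinField E M}
    (hβ : ∀ x v w, β x v w = -β x w v) {x : M} {X Y Z : VField E M}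
    (hX : MDiffAt (T% X) x) (hY : MDiffAt (T% Y) x) (hZ : MDiffAt (T% Z) x) :
    extDeriv₂ β X Y Z x = covDeriv₂ cov β x (X x) Y Z - covDeriv₂ cov β x (Y x) X Z
      + covDeriv₂ cov β x (Z x) X Y := by
  have hbracket {X Y : VField E M} : MDiffAt (T% X) x → MDiffAt (T% Y) x →
      cov Y x (X x) - cov X x (Y x) = mlieBracket 𝓘(ℝ, E) X Y x :=
    (CovariantDerivative.torsion_eq_zero_iff cov).1 htor
  rw [extDeriv₂, ← hbracket hX hY, ← hbracket hX hZ, ← hbracket hY hZ]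
  simp only [covDeriv₂, map_sub, _root_.sub_apply]
  rw [hβ x (Y x) (cov Z x (X x)), hβ x (X x) (cov Z x (Y x)), hβ x (X x) (cov Y x (Z x))]
  ring

lemma IsParallelForm.isClosedForm (htor : cov.torsion = 0) {β : BilinField E M}
    (hβ : ∀ x v w, β x v w = -β x w v) (h : IsParallelForm cov β) : IsClosedForm β := by
  intro x X Y Z hX hY hZ
  rw [extDeriv₂_eq_covDeriv₂ htor hβ hX hY hZ, h x _ Y Z hY hZ, h x _ X Z hX hZ, h x _ X Y hX hY]
  ring

end Connection

/-! ### Integrability of polynomials in an endomorphism field -/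

section PolynomialStructures

lemma eq_zero_of_commute_of_mul_eq_neg {R : Type*} [Ring R] [Algebra ℝ R] {s t : R}
    (hs : s * s = -1) (hcomm : Commute t s) (hanti : t * s = -(s * t)) : t = 0 := by
  have htwo : (2 : ℝ) • (s * t) = 0 := by
    rw [two_smul, ← eq_neg_iff_add_eq_zero, ← hanti, hcomm.eq]
  have hst : s * t = 0 := (smul_eq_zero.1 htwo).resolve_left two_ne_zero
  simpa only [← mul_assoc, hs, neg_one_mul, neg_eq_zero, mul_zero] using congrArg (s * ·) hst

variable {E : Type*} [NormedAddCommGroup E] [NormedSpace ℝ E] [FiniteDimensional ℝ E]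
  {M : Type*} [TopologicalSpace M] [ChartedSpace E M] [IsManifold 𝓘(ℝ, E) ∞ M]
  {cov : CovariantDerivative 𝓘(ℝ, E) E (fun x : M => TangentSpace 𝓘(ℝ, E) x)}

lemma isComplexStructure_of_aeval (htor : cov.torsion = 0) {A S : EndField E M}
    (hA : IsSmoothEnd A) (hS : IsSmoothEnd S) (hsq : ∀ x v, S x (S x v) = -v)
    (q : M → Polynomial ℝ)
    (hSq : ∀ x, (S x).toLinearMap = Polynomial.aeval
      ((A x).toLinearMap : End ℝ (TangentSpace 𝓘(ℝ, E) x)) (q x))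
    (hcovA : ∀ x w v, covEnd cov hA x (S x w) (S x v) - S x (covEnd cov hA x w (S x v))
      - S x (covEnd cov hA x (S x w) v) - covEnd cov hA x w v = 0) :
    IsComplexStructure S := by
  refine isComplexStructure_of_covEnd htor hS hsq fun x w v => ?_
  set H := covEnd cov hA x
  set N := covEnd cov hS x
  -- Differentiating `AS = SA` turns the hypothesis on `∇A` into the commutation of
  -- `T = ∇_{Sv} S - S ∇_v S` with `A`, hence with `S`; but `T` anticommutes with `S` as `S² = -1`.
  let T : End ℝ (TangentSpace 𝓘(ℝ, E) x) :=
    { toFun w := N w (S x v) - S x (N w v)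
      map_add' _ _ := by simp only [map_add, _root_.add_apply]; abel
      map_smul' _ _ := by
        simp only [map_smul, _root_.smul_apply, RingHom.id_apply, smul_sub] }
  have hT (w) : T w = N w (S x v) - S x (N w v) := rfl
  have hAS (x v) : A x (S x v) = S x (A x v) := by
    have h := commute_aeval (Commute.refl
      ((A x).toLinearMap : End ℝ (TangentSpace 𝓘(ℝ, E) x))) (q x)
    rw [← hSq] at h
    exact LinearMap.congr_fun h.eq v
  have hAN (w v) : A x (N w v) = N (A x w) v + S x (H w v) - H (S x w) v :=
    eq_sub_of_add_eq' (covEnd_apply_add_apply_covEnd hA hS hAS w v)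
  have hTA : Commute T ((A x).toLinearMap : End ℝ (TangentSpace 𝓘(ℝ, E) x)) := by
    refine LinearMap.ext fun w => ?_
    change T (A x w) = A x (T w)
    rw [hT, hT, map_sub, hAS, hAN, hAN, map_sub, map_add, hsq, ← sub_eq_zero, ← hcovA x w v]
    abel
  have hTS : Commute T ((S x).toLinearMap : End ℝ (TangentSpace 𝓘(ℝ, E) x)) := by
    rw [hSq]
    exact commute_aeval hTA (q x)
  have hzero : T = 0 := by
    refine eq_zero_of_commute_of_mul_eq_neg (LinearMap.ext fun w => hsq x w) hTS
      (LinearMap.ext fun w => ?_)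
    change T (S x w) = -S x (T w)
    rw [hT, hT, covEnd_apply_of_sq hS hsq, covEnd_apply_of_sq hS hsq, map_sub, map_neg]
    abel
  exact sub_eq_zero.1 (LinearMap.congr_fun hzero w)

end PolynomialStructures

/-! ### The Kähler form is parallel -/

section Kaehler

/- In the application `F u y z = ⟪(∇_u J) y, z⟫`; the last two hypotheses are `dω = 0` and the
vanishing of the Nijenhuis tensor. -/
lemma eq_zero_of_cyclic_of_nijenhuis {V : Type*} [AddCommGroup V] {J : V → V}
    (hJ : ∀ v, J (J v) = -v) {F : V → V → V → ℝ} (hneg : ∀ u y z, F u y (-z) = -F u y z)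
    (hswap : ∀ u y z, F u y z = -F u z y) (hFJ : ∀ u y z, F u (J y) z = F u y (J z))
    (hcyclic : ∀ u y z, F u y z + F y z u + F z u y = 0)
    (hnijenhuis : ∀ u y z,
      F (J u) y z - F (J y) u z - F y u (J z) + F u y (J z) = 0) (u y z : V) :
    F u y z = 0 := by
  have hcyclicJ := hcyclic u (J y) (J z)
  have hnijenhuisJ := hnijenhuis y z (J u)
  rw [hFJ u y (J z), hJ, hneg] at hcyclicJ
  rw [hJ, hneg, hneg] at hnijenhuisJ
  linarith [hcyclic u y z, hswap (J z) u (J y), hFJ (J z) y u, hswap z u y, hFJ (J y) z u]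

variable {E : Type*} [NormedAddCommGroup E] [NormedSpace ℝ E]
  {M : Type*} [TopologicalSpace M] [ChartedSpace E M]
  [RiemannianBundle (fun x : M => TangentSpace 𝓘(ℝ, E) x)]

lemma IsOrthogonalEnd.inner_apply_left {J : EndField E M} (h : IsOrthogonalEnd J)
    (hsq : ∀ x v, J x (J x v) = -v) {x : M} (v w : TangentSpace 𝓘(ℝ, E) x) :
    inner ℝ (J x v) w = -(inner ℝ v (J x w) : ℝ) := by
  rw [← h x v (J x w), hsq, inner_neg_right, neg_neg]

lemma IsOrthogonalEnd.inner_apply_self {J : EndField E M} (h : IsOrthogonalEnd J)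
    (hsq : ∀ x v, J x (J x v) = -v) {x : M} (v : TangentSpace 𝓘(ℝ, E) x) :
    inner ℝ (J x v) v = (0 : ℝ) := by
  linarith [h.inner_apply_left hsq v v, real_inner_comm (J x v) v]

variable [FiniteDimensional ℝ E] [IsManifold 𝓘(ℝ, E) ∞ M]
  {cov : CovariantDerivative 𝓘(ℝ, E) E (fun x : M => TangentSpace 𝓘(ℝ, E) x)}

namespace IsLeviCivita

lemma covDeriv₂_eq_inner (hcov : IsLeviCivita cov) {β : BilinField E M} {A : EndField E M}
    (hA : IsSmoothEnd A) (hβ : ∀ x v w, β x v w = inner ℝ v (A x w)) {x : M}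
    (v : TangentSpace 𝓘(ℝ, E) x) {Y Z : VField E M} (hY : MDiffAt (T% Y) x)
    (hZ : MDiffAt (T% Z) x) :
    covDeriv₂ cov β x v Y Z = inner ℝ (Y x) (covEnd cov hA x (Z x) v) := by
  have h := hcov.metric x v Y (A.app Z) hY (hA.mdifferentiableAt_app hZ)
  simp only [EndField.app] at h
  rw [covDeriv₂, covEnd_apply hA hZ, inner_sub_right, hβ, hβ]
  simp only [hβ]
  linarith

lemma covDeriv₂_fundForm (hcov : IsLeviCivita cov) {J : EndField E M} (hJ : IsSmoothEnd J) {x : M}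
    (v : TangentSpace 𝓘(ℝ, E) x) {Y Z : VField E M} (hY : MDiffAt (T% Y) x)
    (hZ : MDiffAt (T% Z) x) :
    covDeriv₂ cov (fundForm J) x v Y Z = inner ℝ (covEnd cov hJ x (Y x) v) (Z x) := by
  have h := hcov.metric x v (J.app Y) Z (hJ.mdifferentiableAt_app hY) hZ
  simp only [EndField.app] at h
  rw [covDeriv₂, covEnd_apply hJ hY, inner_sub_left]
  simp only [fundForm_apply]
  linarith

lemma inner_covEnd (hcov : IsLeviCivita cov) {J : EndField E M} (hJ : IsSmoothEnd J)
    (hskew : ∀ x (v w : TangentSpace 𝓘(ℝ, E) x), inner ℝ (J x v) w = -(inner ℝ v (J x w) : ℝ))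
    {x : M} (u v w : TangentSpace 𝓘(ℝ, E) x) :
    inner ℝ (covEnd cov hJ x w v) u = -(inner ℝ w (covEnd cov hJ x u v) : ℝ) := by
  obtain ⟨W, hW, rfl⟩ := exists_mdifferentiableAt_eq w
  obtain ⟨U, hU, rfl⟩ := exists_mdifferentiableAt_eq u
  have hJW := hcov.metric x v (J.app W) U (hJ.mdifferentiableAt_app hW) hU
  have hJU := hcov.metric x v W (J.app U) hW (hJ.mdifferentiableAt_app hU)
  have hfun : (fun y => (inner ℝ (J.app W y) (U y) : ℝ)) =
      -fun y => (inner ℝ (W y) (J.app U y) : ℝ) := funext fun y => hskew y (W y) (U y)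
  rw [hfun, mvfderiv_neg, _root_.neg_apply, hJU] at hJW
  rw [covEnd_apply hJ hW, covEnd_apply hJ hU, inner_sub_left, inner_sub_right,
    hskew x (cov W x v)]
  simp only [EndField.app] at hJW ⊢
  linarith [hskew x (W x) (cov U x v)]

lemma cyclic_inner_covEnd (hcov : IsLeviCivita cov) {J : EndField E M} (hJ : IsSmoothEnd J)
    (hskew : ∀ x (v w : TangentSpace 𝓘(ℝ, E) x), inner ℝ (J x v) w = -(inner ℝ v (J x w) : ℝ))
    (hclosed : IsClosedForm (fundForm J)) {x : M} (u v w : TangentSpace 𝓘(ℝ, E) x) :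
    inner ℝ (covEnd cov hJ x v u) w + inner ℝ (covEnd cov hJ x w v) u
      + inner ℝ (covEnd cov hJ x u w) v = (0 : ℝ) := by
  obtain ⟨X, hX, rfl⟩ := exists_mdifferentiableAt_eq u
  obtain ⟨Y, hY, rfl⟩ := exists_mdifferentiableAt_eq v
  obtain ⟨Z, hZ, rfl⟩ := exists_mdifferentiableAt_eq w
  have hd := hclosed x X Y Z hX hY hZ
  rw [extDeriv₂_eq_covDeriv₂ hcov.torsion
      (fun x v w => by rw [fundForm_apply, fundForm_apply, hskew, real_inner_comm]) hX hY hZ,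
    hcov.covDeriv₂_fundForm hJ _ hY hZ, hcov.covDeriv₂_fundForm hJ _ hX hZ,
    hcov.covDeriv₂_fundForm hJ _ hX hY] at hd
  have hswap := hcov.inner_covEnd hJ hskew (X x) (Y x) (Z x)
  rw [real_inner_comm (covEnd cov hJ x (X x) (Y x))] at hswap
  linarith

lemma covEnd_eq_zero (hcov : IsLeviCivita cov) {J : EndField E M} (hJ : IsKaehler J)
    (x : M) (w v : TangentSpace 𝓘(ℝ, E) x) :
    covEnd cov hJ.complex.smooth x w v = 0 := by
  have hsmooth := hJ.complex.smooth
  have hsq := hJ.complex.sq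
  have hskew x (v w : TangentSpace 𝓘(ℝ, E) x) :
      inner ℝ (J x v) w = -(inner ℝ v (J x w) : ℝ) := hJ.hermitian.inner_apply_left hsq v w
  have hzero := eq_zero_of_cyclic_of_nijenhuis (hsq x)
    (F := fun u y z => inner ℝ (covEnd cov hsmooth x y u) z)
    (fun u y z => inner_neg_right _ _)
    (fun u y z => by rw [hcov.inner_covEnd hsmooth hskew, real_inner_comm])
    (fun u y z => by rw [covEnd_apply_of_sq hsmooth hsq, inner_neg_left, hskew, neg_neg])
    (fun u y z => hcov.cyclic_inner_covEnd hsmooth hskew hJ.closed u y z)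
    (fun u y z => by
      obtain ⟨X, hX, rfl⟩ := exists_mdifferentiableAt_eq u
      obtain ⟨Y, hY, rfl⟩ := exists_mdifferentiableAt_eq y
      have hN := hJ.complex.integrable x X Y hX hY
      rw [nijenhuis_eq_covEnd hcov.torsion hsmooth hsq hX hY] at hN
      have hNz := congrArg (fun t => (inner ℝ t z : ℝ)) hN
      simp only [inner_sub_left, inner_add_left, inner_zero_left, hskew] at hNz
      linarith)
    v w (covEnd cov hsmooth x w v)
  exact inner_self_eq_zero.1 hzero

end IsLeviCivita

end Kaehler

/-! ### Complex structures from a Hamiltonian form -/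

section Hamiltonian

variable {E : Type*} [NormedAddCommGroup E] [NormedSpace ℝ E] [FiniteDimensional ℝ E]
  {M : Type*} [TopologicalSpace M] [ChartedSpace E M] [IsManifold 𝓘(ℝ, E) ∞ M]
  [RiemannianBundle (fun x : M => TangentSpace 𝓘(ℝ, E) x)]
  {cov : CovariantDerivative 𝓘(ℝ, E) E (fun x : M => TangentSpace 𝓘(ℝ, E) x)}
  {J : EndField E M} {ψ : BilinField E M} {σ : M → ℝ}

namespace IsHamiltonian

lemma sharp_apply_comm (hψ : IsHamiltonian cov J ψ σ) (hsq : ∀ x v, J x (J x v) = -v)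
    (horth : IsOrthogonalEnd J) (x : M) (v : TangentSpace 𝓘(ℝ, E) x) :
    sharp ψ x (J x v) = J x (sharp ψ x v) := by
  refine ext_inner_left ℝ fun u => ?_
  rw [inner_sharp, ← neg_eq_iff_eq_neg.2 (horth.inner_apply_left hsq u (sharp ψ x v)),
    inner_sharp, ← hψ.oneOne x u, hsq, map_neg]

variable [IsContMDiffRiemannianBundle 𝓘(ℝ, E) ∞ E (fun x : M => TangentSpace 𝓘(ℝ, E) x)]

lemma inner_covEnd_sharp (hψ : IsHamiltonian cov J ψ σ) (hcov : IsLeviCivita cov) {x : M}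
    (u v w : TangentSpace 𝓘(ℝ, E) x) :
    inner ℝ u (covEnd cov hψ.form.isSmoothEnd_sharp x w v) =
      1 / 2 * (
        (mvfderiv 𝓘(ℝ, E) σ x u * inner ℝ (J x v) w - mvfderiv 𝓘(ℝ, E) σ x w * inner ℝ (J x v) u)
        + (mvfderiv 𝓘(ℝ, E) σ x (J x u) * inner ℝ v w
          - mvfderiv 𝓘(ℝ, E) σ x (J x w) * inner ℝ v u) : ℝ) := by
  obtain ⟨U, hU, rfl⟩ := exists_mdifferentiableAt_eq u
  obtain ⟨W, hW, rfl⟩ := exists_mdifferentiableAt_eq w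
  rw [← hcov.covDeriv₂_eq_inner hψ.form.isSmoothEnd_sharp
    (fun x v w => (inner_sharp ψ x v w).symm) v hU hW, hψ.eqn x v U W hU hW]
  ring

lemma nijenhuis_covEnd_sharp (hψ : IsHamiltonian cov J ψ σ) (hcov : IsLeviCivita cov)
    {S : EndField E M} (hsq : ∀ x v, S x (S x v) = -v) (horth : IsOrthogonalEnd S) {x : M}
    (hJS : ∀ v, J x (S x v) = S x (J x v)) (v w : TangentSpace 𝓘(ℝ, E) x) :
    covEnd cov hψ.form.isSmoothEnd_sharp x (S x w) (S x v)
      - S x (covEnd cov hψ.form.isSmoothEnd_sharp x w (S x v))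
      - S x (covEnd cov hψ.form.isSmoothEnd_sharp x (S x w) v)
      - covEnd cov hψ.form.isSmoothEnd_sharp x w v = 0 := by
  refine ext_inner_left ℝ fun u => ?_
  have hskew (a b : TangentSpace 𝓘(ℝ, E) x) :
      inner ℝ a (S x b) = -(inner ℝ (S x a) b : ℝ) := by
    rw [horth.inner_apply_left hsq, neg_neg]
  have hJv (u) : inner ℝ (J x (S x v)) (S x u) = (inner ℝ (J x v) u : ℝ) := by
    rw [hJS, horth]
  simp only [inner_sub_right, inner_zero_right, hskew u, hψ.inner_covEnd_sharp hcov, hJv,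
    horth x v, hskew v, hskew (J x v), ← hJS]
  ring

lemma isComplexStructure_of_aeval (hψ : IsHamiltonian cov J ψ σ) (hcov : IsLeviCivita cov)
    (hJsq : ∀ x v, J x (J x v) = -v) (hJorth : IsOrthogonalEnd J) {S : EndField E M}
    (hS : IsSmoothEnd S) (hsq : ∀ x v, S x (S x v) = -v) (horth : IsOrthogonalEnd S)
    (q : M → Polynomial ℝ)
    (hSq : ∀ x, (S x).toLinearMap = Polynomial.aeval
      ((sharp ψ x).toLinearMap : End ℝ (TangentSpace 𝓘(ℝ, E) x)) (q x)) :
    IsComplexStructure S := by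
  refine HamiltonianForms.isComplexStructure_of_aeval hcov.torsion hψ.form.isSmoothEnd_sharp hS
    hsq q hSq fun x w v => hψ.nijenhuis_covEnd_sharp hcov hsq horth (fun v => ?_) v w
  have hcomm : Commute ((J x).toLinearMap : End ℝ (TangentSpace 𝓘(ℝ, E) x))
      (sharp ψ x).toLinearMap :=
    LinearMap.ext fun v => (hψ.sharp_apply_comm hJsq hJorth x v).symm
  have hJS := commute_aeval hcomm (q x)
  rw [← hSq] at hJS
  exact LinearMap.congr_fun hJS.eq v

end IsHamiltonian

end Hamiltonian

/-! ### Involutivity of the bundle `T^{1,0}` -/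

section Involutive

variable {E : Type*} [NormedAddCommGroup E] [NormedSpace ℝ E]
  {M : Type*} [TopologicalSpace M] [ChartedSpace E M]

lemma cvec_mem_eigenspace_I_iff {x : M}
    {S : TangentSpace 𝓘(ℝ, E) x →L[ℝ] TangentSpace 𝓘(ℝ, E) x} (hsq : ∀ v, S (S v) = -v)
    {v w : TangentSpace 𝓘(ℝ, E) x} :
    cvec v w ∈ End.eigenspace (cEnd S) Complex.I ↔ w = -S v := by
  rw [End.mem_eigenspace_iff, cvec, cEnd, baseChange_apply_eq_smul_iff]
  simp only [Complex.I_re, Complex.I_im, zero_smul, one_smul, zero_sub, zero_add,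
    ContinuousLinearMap.coe_coe]
  constructor
  · rintro ⟨h, -⟩
    rw [h, neg_neg]
  · rintro rfl
    simp [hsq]

variable [FiniteDimensional ℝ E] [IsManifold 𝓘(ℝ, E) ∞ M]

lemma IsComplexStructure.isInvolutive_holTangent {S : EndField E M} (hS : IsComplexStructure S) :
    IsInvolutive (holTangent S) := by
  intro U hU X Y X' Y' hX _ hX' _ hXY hXY' x hx
  have hUx : U ∈ nhds x := hU.mem_nhds hx
  have hXd : MDiffAt (T% X) x := (hX.contMDiffAt hUx).mdifferentiableAt (by simp)
  have hXd' : MDiffAt (T% X') x := (hX'.contMDiffAt hUx).mdifferentiableAt (by simp)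
  have hSX := hS.smooth.mdifferentiableAt_app hXd
  have hSX' := hS.smooth.mdifferentiableAt_app hXd'
  have eventually_eq {V W : VField E M} (h : ∀ y ∈ U, cvec (V y) (W y) ∈ holTangent S y) :
      W =ᶠ[nhds x] (-1 : ℝ) • S.app V := by
    filter_upwards [hUx] with y hy
    exact ((cvec_mem_eigenspace_I_iff (hS.sq y)).1 (h y hy)).trans
      (neg_one_smul ℝ (S y (V y))).symm
  have hY_eq := eventually_eq hXY
  have hY'_eq := eventually_eq hXY'
  have hYY' : mlieBracket 𝓘(ℝ, E) Y Y' x = mlieBracket 𝓘(ℝ, E) (S.app X) (S.app X') x := by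
    rw [hY_eq.mlieBracket_vectorField_eq hY'_eq, mlieBracket_const_smul_left hSX,
      mlieBracket_const_smul_right hSX', smul_smul, neg_one_mul, neg_neg, one_smul]
  have hXY' : mlieBracket 𝓘(ℝ, E) X Y' x = (-1 : ℝ) • mlieBracket 𝓘(ℝ, E) X (S.app X') x := by
    rw [(Filter.EventuallyEq.refl _ X).mlieBracket_vectorField_eq hY'_eq,
      mlieBracket_const_smul_right hSX']
  have hYX' : mlieBracket 𝓘(ℝ, E) Y X' x = (-1 : ℝ) • mlieBracket 𝓘(ℝ, E) (S.app X) X' x := by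
    rw [hY_eq.mlieBracket_vectorField_eq (Filter.EventuallyEq.refl _ X'),
      mlieBracket_const_smul_left hSX]
  have hnijenhuis := congrArg (S x) (hS.integrable x X X' hXd hXd')
  simp only [map_sub, hS.sq, map_zero] at hnijenhuis
  refine (cvec_mem_eigenspace_I_iff (hS.sq x)).2 ?_
  rw [hYY', hXY', hYX', map_sub, ← sub_eq_zero, ← neg_eq_zero, ← hnijenhuis]
  module

end Involutive

/-! ### The conformal Killing form -/

section Wedge

/-- The `3`-form `α ∧ β` for a linear form `α` and an alternating bilinear form `β`. -/
noncomputable def wedgeForm {V : Type*} [AddCommGroup V] [Module ℝ V] (α : V →ₗ[ℝ] ℝ)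
    (β : V →ₗ[ℝ] V →ₗ[ℝ] ℝ) (hβ : β.IsAlt) : V [⋀^Fin 3]→ₗ[ℝ] ℝ where
  toFun u := α (u 0) * β (u 1) (u 2) - α (u 1) * β (u 0) (u 2) + α (u 2) * β (u 0) (u 1)
  map_update_add' := by
    intro inst u i v w
    obtain rfl : inst = instDecidableEqFin 3 := Subsingleton.elim _ _
    fin_cases i <;> simp [Function.update] <;> ring
  map_update_smul' := by
    intro inst u i r v
    obtain rfl : inst = instDecidableEqFin 3 := Subsingleton.elim _ _
    fin_cases i <;> simp [Function.update] <;> ring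
  map_eq_zero_of_eq' := by
    intro u i j h hij
    fin_cases i <;> fin_cases j <;>
      simp only [Fin.zero_eta, Fin.mk_one, Fin.reduceFinMk, ne_eq, not_true_eq_false] at h hij ⊢
    all_goals simp only [h, hβ.self_eq_zero]
    all_goals
      first
      | ring1
      | linear_combination -α (u 2) * hβ.neg (u 1) (u 2)
      | linear_combination -α (u 0) * hβ.neg (u 1) (u 0)

lemma wedgeForm_apply {V : Type*} [AddCommGroup V] [Module ℝ V] (α : V →ₗ[ℝ] ℝ)
    {β : V →ₗ[ℝ] V →ₗ[ℝ] ℝ} (hβ : β.IsAlt) (u v w : V) :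
    wedgeForm α β hβ ![u, v, w] = α u * β v w - α v * β u w + α w * β u v :=
  rfl

variable {V : Type*} [NormedAddCommGroup V] [InnerProductSpace ℝ V] [FiniteDimensional ℝ V]

lemma exists_ne_zero_inner_eq_zero (h : 2 < finrank ℝ V) (v w : V) :
    ∃ u : V, u ≠ 0 ∧ inner ℝ v u = (0 : ℝ) ∧ inner ℝ w u = (0 : ℝ) := by
  classical
  set K : Submodule ℝ V := Submodule.span ℝ ((({v, w} : Finset V)) : Set V)
  have hK : finrank ℝ K ≤ 2 := (finrank_span_finset_le_card _).trans Finset.card_le_two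
  have hadd := K.finrank_add_finrank_orthogonal
  have hne : Kᗮ ≠ ⊥ := by
    intro hbot
    rw [hbot, finrank_bot] at hadd
    omega
  obtain ⟨u, hu, hu0⟩ := Submodule.exists_mem_ne_zero_of_ne_bot hne
  rw [Submodule.mem_orthogonal] at hu
  exact ⟨u, hu0, hu v (Submodule.subset_span (by simp)), hu w (Submodule.subset_span (by simp))⟩

lemma eq_zero_of_wedgeForm_eq_zero (h : 2 < finrank ℝ V) {J : V →ₗ[ℝ] V}
    (hsq : ∀ v, J (J v) = -v) (hJ : ((innerₗ V).comp J).IsAlt) {α : V →ₗ[ℝ] ℝ}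
    (hα : wedgeForm α ((innerₗ V).comp J) hJ = 0) : α = 0 := by
  refine LinearMap.ext fun v => ?_
  obtain ⟨u, hu, hvu, hJvu⟩ := exists_ne_zero_inner_eq_zero h v (J v)
  have hωvu : innerₗ V (J v) u = 0 := hJvu
  have hωvJu : innerₗ V (J v) (J u) = 0 := by
    have hneg : -inner ℝ (J v) (J u) = inner ℝ (J (J u)) v := hJ.neg v (J u)
    rw [hsq, inner_neg_left, real_inner_comm v u, hvu, neg_zero, neg_eq_zero] at hneg
    exact hneg
  have hωuJu : innerₗ V (J u) (J u) ≠ 0 := by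
    refine inner_self_ne_zero.2 fun hJu => hu ?_
    rw [← neg_eq_zero, ← hsq, hJu, map_zero]
  have hval := DFunLike.congr_fun hα ![v, u, J u]
  simp only [wedgeForm_apply, LinearMap.comp_apply, hωvu, hωvJu, AlternatingMap.zero_apply,
    mul_zero, sub_zero, add_zero] at hval
  exact (mul_eq_zero.1 hval).resolve_right hωuJu

end Wedge

section ConformalKilling

variable {E : Type*} [NormedAddCommGroup E] [NormedSpace ℝ E]
  {M : Type*} [TopologicalSpace M] [ChartedSpace E M] [IsManifold 𝓘(ℝ, E) ∞ M]
  {cov : CovariantDerivative 𝓘(ℝ, E) E (fun x : M => TangentSpace 𝓘(ℝ, E) x)}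

lemma covDeriv₂_sub {β γ : BilinField E M} {x : M} (v : TangentSpace 𝓘(ℝ, E) x)
    {Y Z : VField E M} (hβ : MDiffAt (fun y => β y (Y y) (Z y)) x)
    (hγ : MDiffAt (fun y => γ y (Y y) (Z y)) x) :
    covDeriv₂ cov (β - γ) x v Y Z = covDeriv₂ cov β x v Y Z - covDeriv₂ cov γ x v Y Z := by
  have hfun : (fun y => (β - γ) y (Y y) (Z y)) =
      (fun y => β y (Y y) (Z y)) - fun y => γ y (Y y) (Z y) := rfl
  rw [covDeriv₂, covDeriv₂, covDeriv₂, hfun, mvfderiv_sub hβ hγ]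
  simp only [Pi.sub_apply, _root_.sub_apply]
  ring

lemma covDeriv₂_smul {f : M → ℝ} {β : BilinField E M} {x : M} (v : TangentSpace 𝓘(ℝ, E) x)
    {Y Z : VField E M} (hf : MDiffAt f x) (hβ : MDiffAt (fun y => β y (Y y) (Z y)) x) :
    covDeriv₂ cov (fun y => f y • β y) x v Y Z =
      mvfderiv 𝓘(ℝ, E) f x v * β x (Y x) (Z x) + f x * covDeriv₂ cov β x v Y Z := by
  have hfun : (fun y => (f y • β y) (Y y) (Z y)) = f * fun y => β y (Y y) (Z y) := rfl
  rw [covDeriv₂, covDeriv₂, hfun, mvfderiv_mul hf hβ]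
  simp only [_root_.smul_apply, _root_.add_apply, smul_eq_mul]
  ring

variable [RiemannianBundle (fun x : M => TangentSpace 𝓘(ℝ, E) x)]
  {J : EndField E M} {ψ : BilinField E M} {σ : M → ℝ}

lemma IsKaehler.isAlt (hJ : IsKaehler J) (x : M) :
    ((innerₗ (TangentSpace 𝓘(ℝ, E) x)).comp (J x).toLinearMap).IsAlt :=
  hJ.hermitian.inner_apply_self hJ.complex.sq

variable [IsContMDiffRiemannianBundle 𝓘(ℝ, E) ∞ E (fun x : M => TangentSpace 𝓘(ℝ, E) x)]

lemma mdifferentiableAt_inner {x : M} {Y Z : VField E M} (hY : MDiffAt (T% Y) x)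
    (hZ : MDiffAt (T% Z) x) : MDiffAt (fun y => (inner ℝ (Y y) (Z y) : ℝ)) x :=
  MDifferentiableAt.inner_bundle (IB := 𝓘(ℝ, E)) (F := E)
    (E := fun x : M => TangentSpace 𝓘(ℝ, E) x) (b := fun y => y) hY hZ

variable [FiniteDimensional ℝ E]

lemma IsKaehler.isTwoForm_shiftedForm (hJ : IsKaehler J) (hψ : IsHamiltonian cov J ψ σ) :
    IsTwoForm (shiftedForm J ψ σ) :=
  hψ.form.shiftedForm hJ.complex.smooth (fun x => hJ.isAlt x) hψ.smooth

namespace IsHamiltonian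

lemma covDeriv₂_shiftedForm (hψ : IsHamiltonian cov J ψ σ) (hcov : IsLeviCivita cov)
    (hJ : IsKaehler J) {x : M} (v : TangentSpace 𝓘(ℝ, E) x) {Y Z : VField E M}
    (hY : MDiffAt (T% Y) x) (hZ : MDiffAt (T% Z) x) :
    covDeriv₂ cov (shiftedForm J ψ σ) x v Y Z =
      -(1 / 2) * wedgeForm (mvfderiv 𝓘(ℝ, E) σ x).toLinearMap _ (hJ.isAlt x) ![v, Y x, Z x]
        + 1 / 2 * (mvfderiv 𝓘(ℝ, E) σ x (J x (Y x)) * inner ℝ v (Z x)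
          - mvfderiv 𝓘(ℝ, E) σ x (J x (Z x)) * inner ℝ v (Y x)) := by
  have hψYZ : MDiffAt (fun y => ψ y (Y y) (Z y)) x := by
    simp only [← inner_sharp]
    exact mdifferentiableAt_inner hY (hψ.form.isSmoothEnd_sharp.mdifferentiableAt_app hZ)
  have hωYZ : MDiffAt (fun y => fundForm J y (Y y) (Z y)) x :=
    mdifferentiableAt_inner (hJ.complex.smooth.mdifferentiableAt_app hY) hZ
  have hσ : MDiffAt σ x := (hψ.smooth x).mdifferentiableAt (by simp)
  have hhalf_eq : (fun y => σ y / 2) = (fun _ => (1 / 2 : ℝ)) * σ :=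
    funext fun y => by simp [div_eq_inv_mul]
  have hhalf : MDiffAt (fun y => σ y / 2) x := by
    rw [hhalf_eq]
    exact mdifferentiableAt_const.mul hσ
  have hdhalf : mvfderiv 𝓘(ℝ, E) (fun y => σ y / 2) x v = 1 / 2 * mvfderiv 𝓘(ℝ, E) σ x v := by
    rw [hhalf_eq, mvfderiv_mul mdifferentiableAt_const hσ]
    simp [mvfderiv_const]
  change covDeriv₂ cov (ψ - fun y => (σ y / 2) • fundForm J y) x v Y Z = _
  rw [covDeriv₂_sub v hψYZ (hhalf.mul hωYZ), covDeriv₂_smul v hhalf hωYZ, hψ.eqn x v Y Z hY hZ,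
    hcov.covDeriv₂_fundForm hJ.complex.smooth v hY hZ, hcov.covEnd_eq_zero hJ, inner_zero_left,
    hdhalf, fundForm_apply]
  simp only [wedgeForm_apply, LinearMap.comp_apply, ContinuousLinearMap.coe_coe,
    innerₗ_apply_apply]
  ring

lemma isConformalKilling_shiftedForm {m : ℕ} (hdim : finrank ℝ E = 2 * m)
    (hψ : IsHamiltonian cov J ψ σ) (hcov : IsLeviCivita cov) (hJ : IsKaehler J) :
    IsConformalKilling cov (shiftedForm J ψ σ) := by
  refine ⟨hJ.isTwoForm_shiftedForm hψ,
    fun x => (-(3 / 2) : ℝ) • wedgeForm (mvfderiv 𝓘(ℝ, E) σ x).toLinearMap _ (hJ.isAlt x),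
    fun x => (-((finrank ℝ E : ℝ) - 1) / 2) • (mvfderiv 𝓘(ℝ, E) σ x).comp (J x),
    fun x v Y Z hY hZ => ?_⟩
  have hn : ((finrank ℝ E : ℝ) - 1) ≠ 0 := by
    rw [hdim, sub_ne_zero]
    exact_mod_cast (by omega : 2 * m ≠ 1)
  rw [hψ.covDeriv₂_shiftedForm hcov hJ v hY hZ]
  simp only [ContinuousLinearMap.comp_apply, AlternatingMap.smul_apply, _root_.smul_apply,
    smul_eq_mul]
  field_simp
  ring

lemma extDeriv₂_shiftedForm (hψ : IsHamiltonian cov J ψ σ) (hcov : IsLeviCivita cov)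
    (hJ : IsKaehler J) {x : M} {X Y Z : VField E M} (hX : MDiffAt (T% X) x)
    (hY : MDiffAt (T% Y) x) (hZ : MDiffAt (T% Z) x) :
    extDeriv₂ (shiftedForm J ψ σ) X Y Z x =
      -(3 / 2) * wedgeForm (mvfderiv 𝓘(ℝ, E) σ x).toLinearMap _ (hJ.isAlt x) ![X x, Y x, Z x] := by
  have hskew (v w : TangentSpace 𝓘(ℝ, E) x) := (hJ.isAlt x).neg v w
  simp only [LinearMap.comp_apply, ContinuousLinearMap.coe_coe, innerₗ_apply_apply] at hskew
  rw [extDeriv₂_eq_covDeriv₂ hcov.torsion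
      (fun x v w => ((hJ.isTwoForm_shiftedForm hψ).neg_apply w v).symm) hX hY hZ,
    hψ.covDeriv₂_shiftedForm hcov hJ _ hY hZ, hψ.covDeriv₂_shiftedForm hcov hJ _ hX hZ,
    hψ.covDeriv₂_shiftedForm hcov hJ _ hX hY]
  simp only [wedgeForm_apply, LinearMap.comp_apply, ContinuousLinearMap.coe_coe,
    innerₗ_apply_apply]
  rw [← hskew (X x) (Y x), ← hskew (X x) (Z x), ← hskew (Y x) (Z x), real_inner_comm (Y x) (X x),
    real_inner_comm (Z x) (X x), real_inner_comm (Z x) (Y x)]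
  ring

lemma isClosedForm_shiftedForm_iff (hdim : 2 < finrank ℝ E) (hψ : IsHamiltonian cov J ψ σ)
    (hcov : IsLeviCivita cov) (hJ : IsKaehler J) :
    IsClosedForm (shiftedForm J ψ σ) ↔ IsParallelForm cov (shiftedForm J ψ σ) := by
  refine ⟨fun hclosed x v Y Z hY hZ => ?_, IsParallelForm.isClosedForm hcov.torsion
    fun x v w => ((hJ.isTwoForm_shiftedForm hψ).neg_apply w v).symm⟩
  have hwedge : wedgeForm (mvfderiv 𝓘(ℝ, E) σ x).toLinearMap _ (hJ.isAlt x) = 0 := by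
    ext u
    obtain ⟨X, hX, hXu⟩ := exists_mdifferentiableAt_eq (u 0)
    obtain ⟨Y, hY, hYu⟩ := exists_mdifferentiableAt_eq (u 1)
    obtain ⟨Z, hZ, hZu⟩ := exists_mdifferentiableAt_eq (u 2)
    have hd := hclosed x X Y Z hX hY hZ
    rw [hψ.extDeriv₂_shiftedForm hcov hJ hX hY hZ, hXu, hYu, hZu] at hd
    exact (mul_eq_zero.1 hd).resolve_left (by norm_num)
  have hdσ : (mvfderiv 𝓘(ℝ, E) σ x).toLinearMap = 0 :=
    eq_zero_of_wedgeForm_eq_zero hdim (hJ.complex.sq x) (hJ.isAlt x) hwedge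
  have hdσ_apply (u) : mvfderiv 𝓘(ℝ, E) σ x u = 0 := LinearMap.congr_fun hdσ u
  rw [hψ.covDeriv₂_shiftedForm hcov hJ v hY hZ, hwedge, hdσ_apply, hdσ_apply]
  simp

end IsHamiltonian

end ConformalKilling

/-! ### Polynomials in a field of endomorphisms -/

section PolyEnd

open Polynomial

variable {E : Type*} [NormedAddCommGroup E] [NormedSpace ℝ E]
  {M : Type*} [TopologicalSpace M] [ChartedSpace E M]

/-- A polynomial, depending on the point, in a field of endomorphisms. -/
noncomputable def polyEnd (B : EndField E M) (q : M → ℝ[X]) : EndField E M := fun x =>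
  aeval (B x) (q x)

lemma toLinearMap_polyEnd (B : EndField E M) (q : M → ℝ[X]) (x : M) :
    (polyEnd B q x).toLinearMap =
      aeval ((B x).toLinearMap : End ℝ (TangentSpace 𝓘(ℝ, E) x)) (q x) :=
  (aeval_algHom_apply (R := ℝ) (A := TangentSpace 𝓘(ℝ, E) x →L[ℝ] TangentSpace 𝓘(ℝ, E) x)
    (B := End ℝ (TangentSpace 𝓘(ℝ, E) x))
    ({ (ContinuousLinearMap.toLinearMapRingHom :
        (TangentSpace 𝓘(ℝ, E) x →L[ℝ] TangentSpace 𝓘(ℝ, E) x) →+* _) with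
      commutes' := fun _ => rfl } : _ →ₐ[ℝ] _) (B x) (q x)).symm

lemma polyEnd_apply (B : EndField E M) (q : M → ℝ[X]) (x : M) (v : TangentSpace 𝓘(ℝ, E) x) :
    polyEnd B q x v = aeval ((B x).toLinearMap : End ℝ (TangentSpace 𝓘(ℝ, E) x)) (q x) v :=
  LinearMap.congr_fun (toLinearMap_polyEnd B q x) v

variable [IsManifold 𝓘(ℝ, E) ∞ M] {B : EndField E M}

lemma isSmoothEnd_polyEnd_C (B : EndField E M) {f : M → ℝ}
    (hf : ContMDiff 𝓘(ℝ, E) 𝓘(ℝ, ℝ) ∞ f) : IsSmoothEnd (polyEnd B fun x => C (f x)) := by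
  have h : (polyEnd B fun x => C (f x)) =
      fun x => f x • ContinuousLinearMap.id ℝ (TangentSpace 𝓘(ℝ, E) x) := by
    funext x
    ext v
    rw [polyEnd_apply, aeval_C]
    rfl
  rw [h]
  exact IsSmoothEnd.smul hf isSmoothEnd_id

/-- The families of polynomials `q` for which the field of endomorphisms `q(B)` is smooth. -/
noncomputable def smoothPolynomials (B : EndField E M) : Subsemiring (M → ℝ[X]) where
  carrier := {q | IsSmoothEnd (polyEnd B q)}
  mul_mem' {p q} hp hq := by
    have h : polyEnd B (p * q) = fun x => (polyEnd B p x).comp (polyEnd B q x) :=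
      funext fun x => map_mul (aeval (B x)) (p x) (q x)
    change IsSmoothEnd (polyEnd B (p * q))
    rw [h]
    exact IsSmoothEnd.comp hp hq
  add_mem' {p q} hp hq := by
    have h : polyEnd B (p + q) = fun x => polyEnd B p x + polyEnd B q x :=
      funext fun x => map_add (aeval (B x)) (p x) (q x)
    change IsSmoothEnd (polyEnd B (p + q))
    rw [h]
    exact IsSmoothEnd.add hp hq
  one_mem' := by simpa using! isSmoothEnd_polyEnd_C B (f := fun _ => 1) contMDiff_const
  zero_mem' := by simpa using! isSmoothEnd_polyEnd_C B (f := fun _ => 0) contMDiff_const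

lemma const_X_mem_smoothPolynomials (hB : IsSmoothEnd B) :
    (fun _ => X) ∈ smoothPolynomials B := by
  have h : (polyEnd B fun _ => X) = B := funext fun x => aeval_X (B x)
  change IsSmoothEnd (polyEnd B fun _ => X)
  rwa [h]

variable {ι : Type*} [Fintype ι] [DecidableEq ι] {a : ι → M → ℝ}

lemma pairProjection_mem_smoothPolynomials (hB : IsSmoothEnd B) (hpos : ∀ x μ, 0 < a μ x)
    (hinj : ∀ x, Function.Injective fun μ => a μ x)
    (hsmooth : ∀ μ, ContMDiff 𝓘(ℝ, E) 𝓘(ℝ, ℝ) ∞ (a μ)) (μ : ι) :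
    (fun x => pairProjection (fun ν => a ν x) μ) ∈ smoothPolynomials B := by
  have hprod : (fun x => pairProjection (fun ν => a ν x) μ) = ∏ ν ∈ Finset.univ.erase μ,
      (fun x => C (-a μ x ^ 2 - -a ν x ^ 2)⁻¹) * ((fun _ => X) ^ 2 + fun x => C (a ν x ^ 2)) := by
    funext x
    simp [pairProjection, Lagrange.basis, Lagrange.basisDivisor, prod_comp, Finset.prod_apply]
  rw [hprod]
  refine prod_mem fun ν hν => mul_mem (isSmoothEnd_polyEnd_C B ?_) (add_mem
    (pow_mem (const_X_mem_smoothPolynomials hB) 2) (isSmoothEnd_polyEnd_C B ((hsmooth ν).pow 2)))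
  refine ((((hsmooth μ).pow 2).neg).sub (((hsmooth ν).pow 2).neg)).inv₀ fun x => ?_
  rw [sub_ne_zero, Ne, neg_inj, sq_eq_sq₀ (hpos x μ).le (hpos x ν).le]
  exact fun h => Finset.ne_of_mem_erase hν (hinj x h.symm)

lemma isSmoothEnd_polyEnd_signPolynomial (hB : IsSmoothEnd B) (hpos : ∀ x μ, 0 < a μ x)
    (hinj : ∀ x, Function.Injective fun μ => a μ x)
    (hsmooth : ∀ μ, ContMDiff 𝓘(ℝ, E) 𝓘(ℝ, ℝ) ∞ (a μ)) (s : ι → Bool) :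
    IsSmoothEnd (polyEnd B fun x => signPolynomial (fun ν => a ν x) s) := by
  have hsum : (fun x => signPolynomial (fun ν => a ν x) s) = ∑ μ,
      (fun x => C (if s μ then (a μ x)⁻¹ else -(a μ x)⁻¹)) *
        ((fun _ => X) * fun x => pairProjection (fun ν => a ν x) μ) := by
    funext x
    simp [signPolynomial, Finset.sum_apply]
  have hmem : (fun x => signPolynomial (fun ν => a ν x) s) ∈ smoothPolynomials B := by
    rw [hsum]
    refine sum_mem fun μ _ => mul_mem (isSmoothEnd_polyEnd_C B ?_) (mul_mem
      (const_X_mem_smoothPolynomials hB)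
      (pairProjection_mem_smoothPolynomials hB hpos hinj hsmooth μ))
    have hinv := (hsmooth μ).inv₀ fun x => (hpos x μ).ne'
    cases s μ
    · exact hinv.neg
    · exact hinv
  exact hmem

end PolyEnd

/-! ### The eigenvalue functions and their distributions -/

section EigenSystem

variable {E : Type*} [NormedAddCommGroup E] [NormedSpace ℝ E]
  {M : Type*} [TopologicalSpace M] [ChartedSpace E M] {m : ℕ}

lemma eventually_ne_zero_of_continuousAt {X : VField E M} {x₀ : M} [IsManifold 𝓘(ℝ, E) 1 M]
    (hX : ContinuousAt (T% X) x₀) (hne : X x₀ ≠ 0) : ∀ᶠ x in nhds x₀, X x ≠ 0 := by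
  let e := trivializationAt E (TangentSpace 𝓘(ℝ, E) : M → Type _) x₀
  have hx₀ : x₀ ∈ e.baseSet := FiberBundle.mem_baseSet_trivializationAt' x₀
  have hne' : (e (T% X x₀)).2 ≠ 0 := (e.linearEquivAt ℝ x₀ hx₀).map_ne_zero_iff.2 hne
  filter_upwards [((FiberBundle.continuousAt_totalSpace E _).1 hX).2.eventually_ne hne',
    e.open_baseSet.mem_nhds hx₀] with x hx hxe hXx
  exact hx ((e.linearEquivAt ℝ x hxe).map_eq_zero_iff.2 hXx)

/-- The eigenvalues of each `B x` are `± i a μ x`, where `0 < a 0 x < a 1 x < ...`; there are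
as many of them as the dimension of the tangent space. -/
structure EigenSystem (B : EndField E M) (a : Fin m → M → ℝ) : Prop where
  strictMono : ∀ x, StrictMono fun μ => a μ x
  exists_isEigenbasis : ∀ x, ∃ b, IsEigenbasis (V := TangentSpace 𝓘(ℝ, E) x) (B x).toLinearMap
    (fun μ => a μ x) b

/-- The almost complex structure whose `T^{1,0}` is spanned by the eigenvectors of `B` selected
by `s`. -/
noncomputable def signStructure (B : EndField E M) (a : Fin m → M → ℝ) (s : Fin m → Bool) :
    EndField E M :=
  polyEnd B fun x => signPolynomial (fun μ => a μ x) s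

lemma toLinearMap_signStructure (B : EndField E M) (a : Fin m → M → ℝ) (s : Fin m → Bool) (x : M) :
    (signStructure B a s x).toLinearMap =
      Polynomial.aeval ((B x).toLinearMap : End ℝ (TangentSpace 𝓘(ℝ, E) x))
        (signPolynomial (fun μ => a μ x) s) :=
  toLinearMap_polyEnd ..

lemma signStructure_apply (B : EndField E M) (a : Fin m → M → ℝ) (s : Fin m → Bool) (x : M)
    (v : TangentSpace 𝓘(ℝ, E) x) :
    signStructure B a s x v =
      Polynomial.aeval ((B x).toLinearMap : End ℝ (TangentSpace 𝓘(ℝ, E) x))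
        (signPolynomial (fun μ => a μ x) s) v :=
  polyEnd_apply ..

namespace EigenSystem

variable {B : EndField E M} {a : Fin m → M → ℝ}

lemma pos (h : EigenSystem B a) (x : M) (μ : Fin m) : 0 < a μ x :=
  (h.exists_isEigenbasis x).choose_spec.pos μ

lemma injective (h : EigenSystem B a) (x : M) : Function.Injective fun μ => a μ x :=
  (h.strictMono x).injective

lemma hasEigenvalue_iff (h : EigenSystem B a) (x : M) (z : ℂ) :
    (cEnd (B x)).HasEigenvalue z ↔ ∃ μ s, signedImag (a μ x) s = z := by
  obtain ⟨b, hb⟩ := h.exists_isEigenbasis x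
  exact hb.hasEigenvalue_iff z

lemma exists_eigenspace_le_of_commute (h : EigenSystem B a) {C : EndField E M} {x : M}
    (hBC : ∀ v, B x (C x v) = C x (B x v)) {z : ℂ} (hz : (cEnd (B x)).HasEigenvalue z) :
    ∃ c : ℂ, End.eigenspace (cEnd (B x)) z ≤ End.eigenspace (cEnd (C x)) c := by
  obtain ⟨b, hb⟩ := h.exists_isEigenbasis x
  exact hb.exists_eigenspace_le_of_commute (LinearMap.ext hBC) hz

lemma signStructure_sq (h : EigenSystem B a) (s : Fin m → Bool) (x : M)
    (v : TangentSpace 𝓘(ℝ, E) x) :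
    signStructure B a s x (signStructure B a s x v) = -v := by
  obtain ⟨b, hb⟩ := h.exists_isEigenbasis x
  rw [signStructure_apply, signStructure_apply]
  exact hb.aeval_signPolynomial_sq s v

variable [IsManifold 𝓘(ℝ, E) ∞ M]

lemma contMDiff [FiniteDimensional ℝ E] (h : EigenSystem B a) (hB : IsSmoothEnd B) (μ : Fin m) :
    ContMDiff 𝓘(ℝ, E) 𝓘(ℝ, ℝ) ∞ (a μ) := by
  refine hB.contMDiff_of_aeval_charpoly h.pos h.strictMono (fun x τ => ?_) μ
  have : FiniteDimensional ℝ (TangentSpace 𝓘(ℝ, E) x) := inferInstanceAs (FiniteDimensional ℝ E)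
  obtain ⟨b, hb⟩ := h.exists_isEigenbasis x
  exact hb.aeval_charpoly τ

lemma isSmoothEnd_signStructure [FiniteDimensional ℝ E] (h : EigenSystem B a)
    (hB : IsSmoothEnd B) (s : Fin m → Bool) : IsSmoothEnd (signStructure B a s) :=
  isSmoothEnd_polyEnd_signPolynomial hB h.pos h.injective (h.contMDiff hB) s

lemma exists_hasEigenvector_cvec [FiniteDimensional ℝ E] (h : EigenSystem B a)
    (hB : IsSmoothEnd B) (μ : Fin m) (t : Bool) (x₀ : M) :
    ∃ X Y : VField E M, ∀ᶠ x in nhds x₀, CMDiffAt ∞ (T% X) x ∧ CMDiffAt ∞ (T% Y) x ∧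
      (cEnd (B x)).HasEigenvector (signedImag (a μ x) t) (cvec (X x) (Y x)) := by
  have ha := h.contMDiff hB
  set P := polyEnd B fun x => pairProjection (fun ν => a ν x) μ with hP_def
  have hP : IsSmoothEnd P := pairProjection_mem_smoothPolynomials hB h.pos h.injective ha μ
  have hBa : IsSmoothEnd fun x => (if t then -(a μ x)⁻¹ else (a μ x)⁻¹) • B x := by
    have hinv := (ha μ).inv₀ fun x => (h.pos x μ).ne'
    cases t
    · exact IsSmoothEnd.smul hinv hB
    · exact IsSmoothEnd.smul hinv.neg hB
  obtain ⟨b₀, hb₀⟩ := h.exists_isEigenbasis x₀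
  obtain ⟨e, he⟩ := hb₀.exists_aeval_pairProjection_ne_zero μ
  obtain ⟨N, hN, hNe⟩ := FiberBundle.exists_contMDiffOn_extend (k := ∞) 𝓘(ℝ, E) E e
  set X := P.app (FiberBundle.extend E e) with hX_def
  have hX : ∀ᶠ x in nhds x₀, CMDiffAt ∞ (T% X) x := by
    filter_upwards [eventually_mem_nhds_iff.2 hN] with x hx
    exact hP.contMDiffAt_app (hNe.contMDiffAt hx)
  have hX₀ : X x₀ ≠ 0 := by
    rwa [hX_def, EndField.app, FiberBundle.extend_apply_self, hP_def, polyEnd_apply]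
  refine ⟨X, EndField.app (fun x => (if t then -(a μ x)⁻¹ else (a μ x)⁻¹) • B x) X, ?_⟩
  filter_upwards [hX, eventually_ne_zero_of_continuousAt hX.self_of_nhds.continuousAt hX₀]
    with x hXx hne
  refine ⟨hXx, hBa.contMDiffAt_app hXx, ?_, fun hzero => hne ?_⟩
  · obtain ⟨b, hb⟩ := h.exists_isEigenbasis x
    have hmem := hb.mem_eigenspace_of_pairProjection μ t (FiberBundle.extend E e x)
    rw [← polyEnd_apply B (fun x => pairProjection (fun ν => a ν x) μ) x] at hmem
    exact hmem
  · exact (one_tmul_add_I_tmul_eq_zero_iff.1 hzero).1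

end EigenSystem

end EigenSystem

section Riemannian

variable {E : Type*} [NormedAddCommGroup E] [NormedSpace ℝ E] [FiniteDimensional ℝ E]
  {M : Type*} [TopologicalSpace M] [ChartedSpace E M]
  [RiemannianBundle (fun x : M => TangentSpace 𝓘(ℝ, E) x)]
  {m : ℕ} {β : BilinField E M} {a : Fin m → M → ℝ}

namespace EigenSystem

lemma holTangent_signStructure (h : EigenSystem (sharp β) a) (s : Fin m → Bool) :
    holTangent (signStructure (sharp β) a s) = eigenDistribution β a s := by
  funext x
  obtain ⟨b, hb⟩ := h.exists_isEigenbasis x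
  have heigen := hb.eigenspace_aeval_signPolynomial s
  rw [← toLinearMap_signStructure (sharp β) a s x] at heigen
  exact heigen

lemma eigenDistribution_injective (h : EigenSystem (sharp β) a) (x : M) :
    Function.Injective fun s : Fin m → Bool => eigenDistribution β a s x := by
  obtain ⟨b, hb⟩ := h.exists_isEigenbasis x
  exact hb.iSup_eigenspace_injective

lemma signStructure_injective (h : EigenSystem (sharp β) a) (x : M) :
    Function.Injective fun s : Fin m → Bool => signStructure (sharp β) a s x := by
  intro s t hst
  refine h.eigenDistribution_injective x ?_
  simp only [← h.holTangent_signStructure, holTangent]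
  exact congrArg (fun S => End.eigenspace (cEnd S) Complex.I) hst

end EigenSystem

variable [IsManifold 𝓘(ℝ, E) ∞ M]

lemma IsTwoForm.inner_sharp_left (hβ : IsTwoForm β) {x : M} (v w : TangentSpace 𝓘(ℝ, E) x) :
    inner ℝ (sharp β x v) w = -(inner ℝ v (sharp β x w) : ℝ) := by
  rw [real_inner_comm, inner_sharp, inner_sharp, hβ.neg_apply]

lemma IsTwoForm.exists_eigenSystem_sharp (hβ : IsTwoForm β) (hdim : finrank ℝ E = 2 * m)
    (hnd : IsNondegenerate β) (hdist : HasDistinctEigenvalues β) :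
    ∃ a : Fin m → M → ℝ, EigenSystem (sharp β) a := by
  have hinj (x : M) (v : TangentSpace 𝓘(ℝ, E) x) (hv : sharp β x v = 0) : v = 0 :=
    hnd x v fun w => by rw [← neg_eq_zero, hβ.neg_apply, ← inner_sharp, hv, inner_zero_right]
  choose a hpos hmono hev using fun x : M => exists_strictMono_hasEigenvalue_signedImag
    (A := (sharp β x).toLinearMap) hβ.inner_sharp_left (hinj x) ((hdist x).trans hdim)
  refine ⟨fun μ x => a x μ, hmono, fun x => ?_⟩
  refine exists_isEigenbasis_of_hasEigenvalue ?_ (hpos x) (hmono x).injective (hev x)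
  rw [Fintype.card_fin]
  exact hdim

lemma IsHamiltonian.sharp_shiftedForm_apply_comm
    {cov : CovariantDerivative 𝓘(ℝ, E) E (fun x : M => TangentSpace 𝓘(ℝ, E) x)}
    {J : EndField E M} {ψ : BilinField E M} {σ : M → ℝ} (hψ : IsHamiltonian cov J ψ σ)
    (hsq : ∀ x v, J x (J x v) = -v) (horth : IsOrthogonalEnd J) (x : M)
    (v : TangentSpace 𝓘(ℝ, E) x) :
    sharp ψ x (sharp (shiftedForm J ψ σ) x v) = sharp (shiftedForm J ψ σ) x (sharp ψ x v) := by
  have hφ (w : TangentSpace 𝓘(ℝ, E) x) :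
      sharp (shiftedForm J ψ σ) x w = sharp ψ x w + (σ x / 2) • J x w := by
    refine ext_inner_left ℝ fun u => ?_
    rw [inner_sharp, inner_add_right, inner_sharp, real_inner_smul_right]
    change ψ x u w - σ x / 2 * inner ℝ (J x u) w = _
    rw [horth.inner_apply_left hsq]
    ring
  rw [hφ, hφ, map_add, map_smul, hψ.sharp_apply_comm hsq horth]

namespace EigenSystem

lemma isOrthogonalEnd_signStructure (h : EigenSystem (sharp β) a) (hβ : IsTwoForm β)
    (s : Fin m → Bool) : IsOrthogonalEnd (signStructure (sharp β) a s) := by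
  intro x v w
  obtain ⟨b, hb⟩ := h.exists_isEigenbasis x
  rw [signStructure_apply, signStructure_apply]
  exact hb.inner_aeval_signPolynomial hβ.inner_sharp_left s v w

lemma isIsotropic_eigenDistribution (h : EigenSystem (sharp β) a) (hβ : IsTwoForm β)
    (s : Fin m → Bool) : IsIsotropic (eigenDistribution β a s) := by
  rw [← h.holTangent_signStructure s]
  intro x v hv w hw
  exact baseChange_inner_eq_zero_of_mem_eigenspace_I
    (S := (signStructure (sharp β) a s x).toLinearMap)
    (h.isOrthogonalEnd_signStructure hβ s x) hv hw

lemma isSmoothOfRank_eigenDistribution (h : EigenSystem (sharp β) a)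
    (hA : IsSmoothEnd (sharp β)) (s : Fin m → Bool) :
    IsSmoothOfRank (eigenDistribution β a s) m := by
  intro x₀
  choose X Y hXY using fun μ => h.exists_hasEigenvector_cvec hA μ (s μ) x₀
  obtain ⟨U, hUsub, hU, hx₀⟩ := eventually_nhds_iff.1 (Filter.eventually_all.2 hXY)
  refine ⟨U, hU, hx₀, X, Y, fun μ =>
    ⟨fun x hx => (hUsub x hx μ).1.contMDiffWithinAt,
      fun x hx => (hUsub x hx μ).2.1.contMDiffWithinAt⟩, fun x hx => ?_⟩
  have hvec μ := (hUsub x hx μ).2.2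
  obtain ⟨b, hb⟩ := h.exists_isEigenbasis x
  have hinj : Function.Injective fun μ => signedImag (a μ x) (s μ) := fun μ ν hμν =>
    congrArg Prod.fst (signedImag_injective hb.pos hb.injective (a₁ := (μ, s μ))
      (a₂ := (ν, s ν)) hμν)
  refine ⟨End.eigenvectors_linearIndependent' _ _ hinj _ hvec, ?_⟩
  rw [Submodule.span_range_eq_iSup]
  exact iSup_congr fun μ => (hb.eigenspace_eq_span_of_hasEigenvector (k := (μ, s μ)) (hvec μ)).symm

end EigenSystem

end Riemannian

end HamiltonianForms

theorem theorem3 {E : Type*} [NormedAddCommGroup E] [NormedSpace ℝ E] [FiniteDimensional ℝ E]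
    {M : Type*} [TopologicalSpace M] [ChartedSpace E M] [IsManifold 𝓘(ℝ, E) ∞ M]
    [RiemannianBundle (fun x : M => TangentSpace 𝓘(ℝ, E) x)]
    [IsContMDiffRiemannianBundle 𝓘(ℝ, E) ∞ E (fun x : M => TangentSpace 𝓘(ℝ, E) x)]
    (m : ℕ) (hdim : Module.finrank ℝ E = 2 * m)
    (cov : CovariantDerivative 𝓘(ℝ, E) E (fun x : M => TangentSpace 𝓘(ℝ, E) x))
    (hcov : HamiltonianForms.IsLeviCivita cov)
    (J : HamiltonianForms.EndField E M) (hJ : HamiltonianForms.IsKaehler J)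
    (ψ : HamiltonianForms.BilinField E M) (σ : M → ℝ)
    (hψ : HamiltonianForms.IsHamiltonian cov J ψ σ)
    (hnd : HamiltonianForms.IsNondegenerate ψ)
    (hdist : HamiltonianForms.HasDistinctEigenvalues ψ) :
    -- the eigenvalues are `± i a μ` with `0 < a 0 < a 1 < ...` smooth
    (∃ a : Fin m → M → ℝ,
      (∀ μ, ContMDiff 𝓘(ℝ, E) 𝓘(ℝ, ℝ) ∞ (a μ)) ∧
      (∀ x μ, 0 < a μ x) ∧
      (∀ x, StrictMono fun μ => a μ x) ∧
      (∀ x (z : ℂ), (HamiltonianForms.cEnd (HamiltonianForms.sharp ψ x)).HasEigenvalue z ↔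
        ∃ μ, z = (a μ x : ℂ) * Complex.I ∨ z = -((a μ x : ℂ) * Complex.I)) ∧
      -- the `2 ^ m` associated distributions are distinct, maximal isotropic and integrable
      (∀ s : Fin m → Bool,
        HamiltonianForms.IsSmoothOfRank (HamiltonianForms.eigenDistribution ψ a s) m ∧
        HamiltonianForms.IsIsotropic (HamiltonianForms.eigenDistribution ψ a s) ∧
        HamiltonianForms.IsInvolutive (HamiltonianForms.eigenDistribution ψ a s)) ∧
      (∀ x, Function.Injective
        fun s : Fin m → Bool => HamiltonianForms.eigenDistribution ψ a s x) ∧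
      -- and they define `2 ^ m` distinct complex structures, for which the metric is Hermitian
      (∃ 𝒥 : (Fin m → Bool) → HamiltonianForms.EndField E M,
        (∀ s, HamiltonianForms.IsComplexStructure (𝒥 s) ∧
          HamiltonianForms.IsOrthogonalEnd (𝒥 s) ∧
          HamiltonianForms.holTangent (𝒥 s) = HamiltonianForms.eigenDistribution ψ a s) ∧
        (∀ x, Function.Injective fun s : Fin m → Bool => 𝒥 s x))) ∧
    -- `φ = ψ - σ ω / 2` is a conformal Killing-Yano tensor, the eigenvectors of `ψ` are
    -- eigenvectors of `φ`, and `φ` is not closed unless it is parallel (`2 ≤ m`)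
    HamiltonianForms.IsConformalKilling cov (HamiltonianForms.shiftedForm J ψ σ) ∧
    (∀ x (z : ℂ), (HamiltonianForms.cEnd (HamiltonianForms.sharp ψ x)).HasEigenvalue z →
      ∃ z' : ℂ, Module.End.eigenspace (HamiltonianForms.cEnd (HamiltonianForms.sharp ψ x)) z ≤
        Module.End.eigenspace (HamiltonianForms.cEnd
          (HamiltonianForms.sharp (HamiltonianForms.shiftedForm J ψ σ) x)) z') ∧
    (2 ≤ m → (HamiltonianForms.IsClosedForm (HamiltonianForms.shiftedForm J ψ σ) ↔
      HamiltonianForms.IsParallelForm cov (HamiltonianForms.shiftedForm J ψ σ))) := by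
  have hA := hψ.form.isSmoothEnd_sharp
  obtain ⟨a, ha⟩ := hψ.form.exists_eigenSystem_sharp hdim hnd hdist
  have hcs (s : Fin m → Bool) : HamiltonianForms.IsComplexStructure
      (HamiltonianForms.signStructure (HamiltonianForms.sharp ψ) a s) :=
    hψ.isComplexStructure_of_aeval hcov hJ.complex.sq hJ.hermitian
      (ha.isSmoothEnd_signStructure hA s) (ha.signStructure_sq s)
      (ha.isOrthogonalEnd_signStructure hψ.form s) _
      (HamiltonianForms.toLinearMap_signStructure _ _ s)
  refine ⟨⟨a, ha.contMDiff hA, ha.pos, ha.strictMono, fun x z => ?_, fun s =>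
      ⟨ha.isSmoothOfRank_eigenDistribution hA s, ha.isIsotropic_eigenDistribution hψ.form s,
        ha.holTangent_signStructure s ▸ (hcs s).isInvolutive_holTangent⟩,
      ha.eigenDistribution_injective, HamiltonianForms.signStructure (HamiltonianForms.sharp ψ) a,
      fun s => ⟨hcs s, ha.isOrthogonalEnd_signStructure hψ.form s, ha.holTangent_signStructure s⟩,
      ha.signStructure_injective⟩,
    hψ.isConformalKilling_shiftedForm hdim hcov hJ,
    fun x z hz => ha.exists_eigenspace_le_of_commute
      (hψ.sharp_shiftedForm_apply_comm hJ.complex.sq hJ.hermitian x) hz,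
    fun hm => hψ.isClosedForm_shiftedForm_iff (by omega) hcov hJ⟩
  simp [ha.hasEigenvalue_iff, HamiltonianForms.signedImag, or_comm, eq_comm]
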